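/- Consider a multi-unit auction with unit demand: $m$ identical units are for sale to $n$ agents, where $1\le m<n$; each agent wants at most one unit; agent $i$'s type $\theta_i\in[L,U]$, where $0\le L\le U$, is his valuation for winning one unit. A decision is a set of at most $m$ winners, and $v_i(d,\theta_i)$ equals $\theta_i$ if $i$ wins under $d$ and $0$ otherwise. A mechanism $(f,t)$ maps each type profile $\theta\in[L,U]^n$ to a decision $f(\theta)$ and payments $t_1(\theta),\dots,t_n(\theta)\in\mathbb R$; the utility of agent $i$ is $v_i(f(\theta),\theta_i)-t_i(\theta)$. It is *non-deficit* if $\sum_i t_i(\theta)\ge 0$ for all $\theta$. It is a *Groves mechanism* if $f(\theta)$ always maximizes $\sum_i v_i(d,\theta_i)$ over $d$ and $t_i(\theta)=h_i(\theta_{-i})-\sum_{j\ne i}v_j(f(\theta),\theta_j)$ for some functions $h_i$ of the other agents' types $\theta_{-i}$. Every Groves mechanism can be written $t_i(\theta)=\mathrm{VCG}_i(\theta)-r_i(\theta_{-i})$, where $\mathrm{VCG}_i(\theta)=\max_d\sum_{j\ne i}v_j(d,\theta_j)-\sum_{j\neq i}v_j(f(\theta),\theta_j)$; the $r_i$ are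 its redistribution functions. It is *anonymous* if all $r_i$ are one and the same permutation-invariant function $r$, and *anonymous linear* if moreover $$r(\theta_{-i})=c_0+\sum_{j=1}^{n-1}c_j[\theta_{-i}]_j$$ for some real constants $c_0,\dots,c_{n-1}$, where $[\theta_{-i}]_j$ is the $j$-th highest entry of $\theta_{-i}$. A mechanism *individually dominates* another if for every type profile every agent's utility (at his true type) is at least as large under the former as under the latter, with strict inequality for some profile and some agent; it *collectively dominates* the other if the same holds for the sum of all agents' utilities. A non-deficit Groves mechanism is *individually* (*collectively*) *undominated* if no non-deficit Groves mechanism individually (collectively) dominates it. An *OEL mechanism* is a Groves mechanism whose redistribution functions are all given by the displayed formula, with constants $c_0,\dots,c_{n-1}$ chosen as follows for some integer $k\in\{0,\dots,n\}$ with $k-m$ odd. Put $$\alpha_i=(-1)^{m-i}\binom{n-i-1}{n-m-1}\Big/\binom{m-1}{i-1}\ (1\le i\le m),\qquad \beta_i=(-1)^{m-i-1}\binom{i-1}{m-1}\Big/\binom{n-m-1}{n-i-1}\ (m<i<n).$$ All constants not listed are $0$. - $k=0$: $c_i=\alpha_i$ for $1\le i\le m$, and $c_0=Um/n-U\sum_{i=1}^m\alpha_i$.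 - $1\le k\le m$: $c_i=\alpha_i$ for $k<i\le m$, and $c_k=m/n-\sum_{i=k+1}^m\alpha_i$. - $m<k<n$: $c_i=\beta_i$ for $m<i<k$, and $c_k=m/n-\sum_{i=m+1}^{k-1}\beta_i$. - $k=n$: $c_i=\beta_i$ for $m<i<n$, and $c_0=Lm/n-L\sum_{i=m+1}^{n-1}\beta_i$. **Corollary.** For a non-deficit anonymous linear Groves mechanism in this setting, the following are equivalent: it is individually undominated; it is collectively undominated; it is an OEL mechanism. In particular the two notions of undominance coincide within this class. -/

import Mathlib

noncomputable section

namespace Redistribution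

/-! ### Payment-based mechanisms

There are `n` agents with a common type set `Θ`, a set `D` of decisions, and initial
utilities `v i : D → Θ → ℝ`. -/

/-- A payment-based mechanism: a decision function `f` and payments `t`, where `t θ i` is
what agent `i` pays at the announced type profile `θ`. -/
structure Mechanism (n : ℕ) (D Θ : Type*) where
  f : (Fin n → Θ) → D
  t : (Fin n → Θ) → Fin n → ℝ

section General

variable {n : ℕ} {D Θ : Type*}

/-- Final (quasilinear) utility of agent `i` when all agents announce their true types. -/
def utility (v : Fin n → D → Θ → ℝ) (M : Mechanism n D Θ) (θ : Fin n → Θ) (i : Fin n) : ℝ :=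
  v i (M.f θ) (θ i) - M.t θ i

/-- The decision function always maximizes the total valuation of the agents. -/
def Efficient (v : Fin n → D → Θ → ℝ) (f : (Fin n → Θ) → D) : Prop :=
  ∀ θ d, ∑ i, v i d (θ i) ≤ ∑ i, v i (f θ) (θ i)

/-- The total payment is never negative. -/
def NonDeficit (M : Mechanism n D Θ) : Prop :=
  ∀ θ, 0 ≤ ∑ i, M.t θ i

/-- `M'` individually dominates `M`. -/
def IndividuallyDominates (v : Fin n → D → Θ → ℝ) (M' M : Mechanism n D Θ) : Prop :=
  (∀ θ i, utility v M θ i ≤ utility v M' θ i) ∧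
    ∃ θ i, utility v M θ i < utility v M' θ i

/-- `M'` collectively dominates `M`. -/
def CollectivelyDominates (v : Fin n → D → Θ → ℝ) (M' M : Mechanism n D Θ) : Prop :=
  (∀ θ, ∑ i, utility v M θ i ≤ ∑ i, utility v M' θ i) ∧
    ∃ θ, ∑ i, utility v M θ i < ∑ i, utility v M' θ i

end General

/-! ### Groves mechanisms

Here there are `N + 1` agents. The profile `θ₋ᵢ` of the types of the agents other than `i`
is `i.removeNth θ : Fin N → Θ`. -/

section Groves

variable {N : ℕ} {D Θ : Type*}

/-- Groves mechanism: the decision is efficient and agent `i` pays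
`h i θ₋ᵢ - ∑ j ≠ i, v j (f θ) (θ j)`, for arbitrary functions `h i`. -/
def IsGroves (v : Fin (N + 1) → D → Θ → ℝ) (M : Mechanism (N + 1) D Θ) : Prop :=
  Efficient v M.f ∧
    ∃ h : Fin (N + 1) → (Fin N → Θ) → ℝ, ∀ θ i,
      M.t θ i = h i (i.removeNth θ) - ∑ j ∈ Finset.univ.erase i, v j (M.f θ) (θ j)

/-- The set of all non-deficit Groves mechanisms. -/
def nonDeficitGroves (v : Fin (N + 1) → D → Θ → ℝ) : Set (Mechanism (N + 1) D Θ) :=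
  {M | IsGroves v M ∧ NonDeficit M}

/-- Not individually dominated by any non-deficit Groves mechanism. -/
def IndividuallyUndominated (v : Fin (N + 1) → D → Θ → ℝ)
    (M : Mechanism (N + 1) D Θ) : Prop :=
  M ∈ nonDeficitGroves v ∧ ∀ M' ∈ nonDeficitGroves v, ¬ IndividuallyDominates v M' M

/-- Not collectively dominated by any non-deficit Groves mechanism. -/
def CollectivelyUndominated (v : Fin (N + 1) → D → Θ → ℝ)
    (M : Mechanism (N + 1) D Θ) : Prop :=
  M ∈ nonDeficitGroves v ∧ ∀ M' ∈ nonDeficitGroves v, ¬ CollectivelyDominates v M' M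

/-- The VCG (Clarke) payment of agent `i` for the decision function `f`. The supremum is a
maximum whenever `D` is finite and nonempty. -/
def vcgPayment (v : Fin (N + 1) → D → Θ → ℝ) (f : (Fin (N + 1) → Θ) → D)
    (θ : Fin (N + 1) → Θ) (i : Fin (N + 1)) : ℝ :=
  (⨆ d : D, ∑ j ∈ Finset.univ.erase i, v j d (θ j)) -
    ∑ j ∈ Finset.univ.erase i, v j (f θ) (θ j)

/-- `M` is the VCG mechanism combined with the redistribution function `r`: agent `i` pays
his VCG payment and receives `r i θ₋ᵢ`. -/
def HasRedistribution (v : Fin (N + 1) → D → Θ → ℝ) (M : Mechanism (N + 1) D Θ)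
    (r : Fin (N + 1) → (Fin N → Θ) → ℝ) : Prop :=
  ∀ θ i, M.t θ i = vcgPayment v M.f θ i - r i (i.removeNth θ)

/-- `M` is an anonymous Groves mechanism, with redistribution function `ρ` for every agent:
all `r i` coincide with `ρ`, which does not depend on the order of its arguments. -/
def IsAnonymousGroves (v : Fin (N + 1) → D → Θ → ℝ) (M : Mechanism (N + 1) D Θ)
    (ρ : (Fin N → Θ) → ℝ) : Prop :=
  IsGroves v M ∧ (∀ (x : Fin N → Θ) (π : Equiv.Perm (Fin N)), ρ (x ∘ π) = ρ x) ∧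
    HasRedistribution v M (fun _ => ρ)

end Groves

/-! ### Multi-unit auctions with unit demand -/

/-- Decisions: the set of winners, who receive one unit each; `m` units are available. -/
abbrev Allocation (n m : ℕ) : Type := {S : Finset (Fin n) // S.card ≤ m}

/-- The common type set `[L, U]`. -/
abbrev Bid (L U : ℝ) : Type := Set.Icc L U

/-- An agent's type is his valuation for winning one unit. -/
def auctionValue (n m : ℕ) (L U : ℝ) (i : Fin n) (d : Allocation n m) (b : Bid L U) : ℝ :=
  if i ∈ d.1 then (b : ℝ) else 0

/-- The entry of index `j` (counted from `0`) of `x` sorted in decreasing order; so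
`nthHighest x j` is the `(j + 1)`-th highest entry of `x`, counted with multiplicity. -/
def nthHighest {N : ℕ} {α : Type*} [LinearOrder α] (x : Fin N → α) (j : Fin N) : α :=
  x (Tuple.sort x j.rev)

/-- `c 0 + ∑_{j = 1}^{N} c j * [x]_j`, where `[x]_j` is the `j`-th highest entry of `x`. -/
def linearRule {N : ℕ} {L U : ℝ} (c : ℕ → ℝ) (x : Fin N → Bid L U) : ℝ :=
  c 0 + ∑ j : Fin N, c (j + 1) * ((nthHighest x j : Bid L U) : ℝ)

/-- `M` is an anonymous and linear Groves mechanism for the auction of `m` units. -/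
def IsAnonymousLinearGroves {N m : ℕ} {L U : ℝ}
    (M : Mechanism (N + 1) (Allocation (N + 1) m) (Bid L U)) : Prop :=
  ∃ ρ : (Fin N → Bid L U) → ℝ,
    IsAnonymousGroves (auctionValue (N + 1) m L U) M ρ ∧
      ∃ c : ℕ → ℝ, ∀ x, ρ x = linearRule c x

/-- `(-1)^(m-i) * C(n-i-1, n-m-1) / C(m-1, i-1)`, used for `1 ≤ i ≤ m < n`. -/
def oelLow (n m i : ℕ) : ℝ :=
  (-1) ^ (m + i) * ((n - i - 1).choose (n - m - 1) : ℝ) / ((m - 1).choose (i - 1) : ℝ)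

/-- `(-1)^(m-i-1) * C(i-1, m-1) / C(n-m-1, n-i-1)`, used for `m < i < n`. -/
def oelHigh (n m i : ℕ) : ℝ :=
  (-1) ^ (m + i + 1) * ((i - 1).choose (m - 1) : ℝ) / ((n - m - 1).choose (n - i - 1) : ℝ)

/-- The coefficient `c_i` (`0 ≤ i ≤ n - 1`) of the OEL mechanism with index `k`, for `n`
agents, `m` units and type set `[L, U]`. The last case is `k = n`. -/
def oelCoeff (n m : ℕ) (L U : ℝ) (k i : ℕ) : ℝ :=
  if k = 0 then
    if i = 0 then U * m / n - U * ∑ j ∈ Finset.Icc 1 m, oelLow n m j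
    else if i ≤ m then oelLow n m i
    else 0
  else if k ≤ m then
    if i = k then (m : ℝ) / n - ∑ j ∈ Finset.Icc (k + 1) m, oelLow n m j
    else if k < i ∧ i ≤ m then oelLow n m i
    else 0
  else if k < n then
    if i = k then (m : ℝ) / n - ∑ j ∈ Finset.Icc (m + 1) (k - 1), oelHigh n m j
    else if m < i ∧ i < k then oelHigh n m i
    else 0
  else
    if i = 0 then L * m / n - L * ∑ j ∈ Finset.Icc (m + 1) (n - 1), oelHigh n m j
    else if m < i ∧ i < n then oelHigh n m i
    else 0

/-- `M` is an Optimal-in-Expectation Linear (OEL) redistribution mechanism: it is a Groves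
mechanism whose redistribution rule is that of an index `k ∈ {0, …, n}` with `k - m` odd,
where `n = N + 1` is the number of agents. -/
def IsOEL {N m : ℕ} {L U : ℝ}
    (M : Mechanism (N + 1) (Allocation (N + 1) m) (Bid L U)) : Prop :=
  IsGroves (auctionValue (N + 1) m L U) M ∧
    ∃ k : ℕ, k ≤ N + 1 ∧ Odd ((k : ℤ) - (m : ℤ)) ∧
      HasRedistribution (auctionValue (N + 1) m L U) M
        (fun _ => linearRule (oelCoeff (N + 1) m L U k))

end Redistribution

end

/-!
In a Groves mechanism the utility of agent `i` is the maximal welfare minus `h i θ₋ᵢ`, so two such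
mechanisms differ in the sum of utilities by `∑ i, g i θ₋ᵢ` for some functions `g i`.

For the auction, the VCG mechanism collects `m` times the `(m + 1)`-th highest type
(`sum_vcgPayment`). Under a linear rule the total payment, the *surplus*, is therefore an affine
function of the order statistics `U = t₀ ≥ t₁ ≥ ⋯ ≥ tₙ ≥ tₙ₊₁ = L` (`sum_payment_eq_surplus`). On this
simplex it is the combination of its values `sₖ` at the `n + 1` vertices, with weights proportional
to the gaps `tₖ - tₖ₊₁` (`mul_surplus_eq`). The OEL rule of index `k` is the rule for which
all `sⱼ` with `j ≠ k` vanish (`vertexSurplus_oelCoeff`, `eq_oelCoeff`); nonnegativity of `sₖ` forces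
`k - m` to be odd (`odd_of_vertexSurplus_nonneg`).

*Undominated implies OEL.* In an individually undominated mechanism the surplus takes arbitrarily
small values on the profiles extending any given `x = θ₋ᵢ`, since otherwise the difference could be
returned to `i` (`IndividuallyUndominated.exists_sum_lt`). If two of the `sₖ` were positive, a
suitable `x` would have both corresponding gaps so large that one more type cannot make both small
(`exists_surplus_bounded_below`). So the surplus is supported on one gap.

*OEL implies undominated.* The surplus of the OEL mechanism of index `k` is zero whenever `tₖ = tₖ₊₁`.
If a mechanism dominates it collectively, `∑ i, g i θ₋ᵢ` is nonnegative, and zero on these profiles.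
Averaging over permutations replaces the `g i` by one symmetric function `φ`. Inserting into `x` a
second copy `a` of its `k`-th highest entry gives a profile of this kind, whose deletions are `x` and
the tuples obtained from `x` by overwriting an entry by `a`; by induction on the number of entries
different from `a`, `φ x = 0` (`eq_zero_of_sum_removeNth_cons`, `eq_zero_of_sum_removeNth_of_gap`).
-/

namespace Redistribution

open Finset

/-! ### Deleting an entry of a permuted tuple -/

/-- Deleting the `i`-th entry of `θ ∘ σ` gives a rearrangement of `θ` without its entry `σ i`,
by a permutation that does not depend on `θ`. -/
theorem exists_perm_removeNth_comp {N : ℕ} {α : Type*} (σ : Equiv.Perm (Fin (N + 1)))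
    (i : Fin (N + 1)) :
    ∃ π : Equiv.Perm (Fin N), ∀ θ : Fin (N + 1) → α,
      Fin.removeNth i (θ ∘ σ) = (Fin.removeNth (σ i) θ) ∘ π := by
  have hσ : ∀ x : Fin (N + 1), x ≠ i ↔ σ x ≠ σ i := fun x => σ.injective.ne_iff.symm
  refine ⟨((finSuccAboveEquiv i).trans (σ.subtypeEquiv hσ)).trans
    (finSuccAboveEquiv (σ i)).symm, fun θ => ?_⟩
  funext j
  have h := (finSuccAboveEquiv (σ i)).apply_symm_apply
    ((σ.subtypeEquiv hσ) (finSuccAboveEquiv i j))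
  have h2 := congrArg Subtype.val h
  rw [finSuccAboveEquiv_apply] at h2
  simp only [Fin.removeNth_apply, Function.comp_apply, Equiv.trans_apply]
  exact congrArg θ h2.symm

/-- The sum of `φ` over all one-entry deletions of `θ` is a symmetric function of `θ` if `φ`
is symmetric. -/
theorem sum_removeNth_comp_perm {N : ℕ} {α : Type*} {φ : (Fin N → α) → ℝ}
    (hφ : ∀ x (π : Equiv.Perm (Fin N)), φ (x ∘ π) = φ x) (θ : Fin (N + 1) → α)
    (σ : Equiv.Perm (Fin (N + 1))) :
    ∑ i, φ (Fin.removeNth i (θ ∘ σ)) = ∑ i, φ (Fin.removeNth i θ) := by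
  rw [← Equiv.sum_comp σ (fun i => φ (Fin.removeNth i θ))]
  refine sum_congr rfl fun i _ => ?_
  obtain ⟨π, hπ⟩ := exists_perm_removeNth_comp (α := α) σ i
  rw [hπ, hφ]

/-- The symmetrization of `∑ i, g i` over all rearrangements of the arguments. -/
def symmetrized {N : ℕ} {α : Type*} (g : Fin (N + 1) → (Fin N → α) → ℝ) (x : Fin N → α) : ℝ :=
  ∑ i, ∑ e : Equiv.Perm (Fin N), g i (x ∘ e)

theorem symmetrized_comp_perm {N : ℕ} {α : Type*} (g : Fin (N + 1) → (Fin N → α) → ℝ)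
    (x : Fin N → α) (π : Equiv.Perm (Fin N)) :
    symmetrized g (x ∘ π) = symmetrized g x := by
  refine sum_congr rfl fun i _ => ?_
  exact Equiv.sum_comp (Equiv.mulLeft π) (fun e : Equiv.Perm (Fin N) => g i (x ∘ e))

/-- Summing over all rearrangements of the deletions of `θ` amounts to summing over the deletions
of all rearrangements of `θ`. -/
theorem sum_perm_sum_removeNth {N : ℕ} {α : Type*} (g : Fin (N + 1) → (Fin N → α) → ℝ)
    (θ : Fin (N + 1) → α) :
    ∑ σ : Equiv.Perm (Fin (N + 1)), ∑ i, g i (Fin.removeNth i (θ ∘ σ)) =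
      ∑ p, symmetrized g (Fin.removeNth p θ) := by
  unfold symmetrized
  rw [sum_comm]
  conv_rhs => rw [sum_comm]
  refine sum_congr rfl fun i _ => ?_
  obtain ⟨π, hπ⟩ := exists_perm_removeNth_comp (α := α) (Equiv.swap 0 i) i
  -- Precomposing with the transposition of `0` and `i` reduces to the deletion of entry `0`.
  rw [← Equiv.sum_comp (Equiv.mulRight (Equiv.swap 0 i))
    (fun σ : Equiv.Perm (Fin (N + 1)) => g i (Fin.removeNth i (θ ∘ σ)))]
  rw [← Equiv.sum_comp (Equiv.Perm.decomposeFin (n := N)).symm, Fintype.sum_prod_type]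
  refine sum_congr rfl fun p _ => ?_
  obtain ⟨κ, hκ⟩ := exists_perm_removeNth_comp (α := α) (Equiv.swap 0 p) 0
  rw [← Equiv.sum_comp ((Equiv.mulLeft κ).trans (Equiv.mulRight π))
    (fun e : Equiv.Perm (Fin N) => g i ((Fin.removeNth p θ) ∘ e))]
  refine sum_congr rfl fun e _ => ?_
  have h1 := hπ (θ ∘ (Equiv.Perm.decomposeFin.symm (p, e)))
  have h2 := hκ θ
  simp only [Equiv.swap_apply_left, Equiv.swap_apply_right] at h1 h2
  have h3 : Fin.removeNth (0 : Fin (N + 1)) (θ ∘ (Equiv.Perm.decomposeFin.symm (p, e))) =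
      Fin.removeNth (0 : Fin (N + 1)) (θ ∘ (Equiv.swap 0 p)) ∘ e := by
    funext j
    simp [Fin.tail, Equiv.Perm.decomposeFin_symm_apply_succ]
  have h4 : θ ∘ (Equiv.mulRight (Equiv.swap 0 i) (Equiv.Perm.decomposeFin.symm (p, e))) =
      (θ ∘ (Equiv.Perm.decomposeFin.symm (p, e))) ∘ (Equiv.swap 0 i) := rfl
  rw [h4, h1, h3, h2]
  rfl

/-- If inserting `a` into any tuple of a family `X` that is closed under overwriting entries by `a`
makes the sum of a symmetric `φ` over all deletions vanish, then `φ` vanishes on `X`. Deleting an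
old entry different from `a` leaves a tuple with one more `a`, whence an induction on the number of entries
different from `a`. -/
theorem eq_zero_of_sum_removeNth_cons {N : ℕ} {α : Type*} {φ : (Fin N → α) → ℝ}
    (hφ : ∀ x (π : Equiv.Perm (Fin N)), φ (x ∘ π) = φ x) (a : α) (X : Set (Fin N → α))
    (hX : ∀ x ∈ X, ∀ j, Function.update x j a ∈ X)
    (h0 : ∀ x ∈ X, ∑ i, φ (Fin.removeNth i (Fin.cons a x : Fin (N + 1) → α)) = 0) :
    ∀ x ∈ X, φ x = 0 := by
  classical
  have key : ∀ (x : Fin N → α) (j : Fin N),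
      φ (Fin.removeNth j.succ (Fin.cons a x : Fin (N + 1) → α)) = φ (Function.update x j a) := by
    intro x j
    obtain ⟨π, hπ⟩ := exists_perm_removeNth_comp (α := α) (Equiv.swap 0 j.succ) 0
    have h := hπ (Fin.cons a x : Fin (N + 1) → α)
    rw [Equiv.swap_apply_left] at h
    rw [← hφ _ π, ← h]
    congr 1
    funext l
    by_cases hl : l = j
    · subst hl; simp [Fin.removeNth_apply]
    · simp [Fin.removeNth_apply, Equiv.swap_apply_of_ne_of_ne, hl]
  suffices H : ∀ (d : ℕ), ∀ x ∈ X, (univ.filter fun j => x j ≠ a).card = d → φ x = 0 from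
    fun x hx => H _ x hx rfl
  intro d
  induction d using Nat.strong_induction_on with
  | _ d ih =>
    intro x hx hd
    have h := h0 x hx
    rw [Fin.sum_univ_succ] at h
    have h1 : Fin.removeNth (0 : Fin (N + 1)) (Fin.cons a x : Fin (N + 1) → α) = x := by
      funext l; simp [Fin.removeNth_apply]
    simp only [h1, key] at h
    have h2 : ∀ j, φ (Function.update x j a) = if x j = a then φ x else 0 := by
      intro j
      split_ifs with hj
      · rw [← hj, Function.update_eq_self]
      · refine ih _ ?_ _ (hX x hx j) rfl
        rw [← hd]
        apply card_lt_card
        refine ⟨fun l hl => ?_, fun hsub => ?_⟩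
        · by_cases hlj : l = j
          · subst hlj; simpa using hj
          · simpa [hlj] using hl
        · have := hsub (show j ∈ _ by simpa using hj)
          simp at this
    simp only [h2, sum_ite, sum_const_zero, add_zero, sum_const, nsmul_eq_mul] at h
    have h3 : (1 + ((univ.filter fun j => x j = a).card : ℝ)) * φ x = 0 := by linarith
    rcases mul_eq_zero.1 h3 with h4 | h4
    · exact absurd h4 (by positivity)
    · exact h4

/-! ### Dominance between Groves mechanisms -/

section Groves

variable {N : ℕ} {D Θ : Type*}

theorem sum_utility (v : Fin (N + 1) → D → Θ → ℝ) (M : Mechanism (N + 1) D Θ)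
    (θ : Fin (N + 1) → Θ) :
    ∑ i, utility v M θ i = ∑ i, v i (M.f θ) (θ i) - ∑ i, M.t θ i := by
  simp [utility, sum_sub_distrib]

/-- In a Groves mechanism an agent's utility is the maximal welfare minus his `h`-term. -/
theorem utility_eq_of_groves {v : Fin (N + 1) → D → Θ → ℝ} {M : Mechanism (N + 1) D Θ}
    {h : Fin (N + 1) → (Fin N → Θ) → ℝ}
    (hM : ∀ θ i, M.t θ i = h i (Fin.removeNth i θ) - ∑ j ∈ univ.erase i, v j (M.f θ) (θ j))
    (θ : Fin (N + 1) → Θ) (i : Fin (N + 1)) :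
    utility v M θ i = ∑ j, v j (M.f θ) (θ j) - h i (Fin.removeNth i θ) := by
  rw [utility, hM, ← add_sum_erase univ (fun j => v j (M.f θ) (θ j)) (mem_univ i)]
  ring

theorem CollectivelyUndominated.individuallyUndominated {v : Fin (N + 1) → D → Θ → ℝ}
    {M : Mechanism (N + 1) D Θ} (h : CollectivelyUndominated v M) :
    IndividuallyUndominated v M := by
  refine ⟨h.1, fun M' hM' hd => h.2 M' hM' ⟨fun θ => sum_le_sum fun i _ => hd.1 θ i, ?_⟩⟩
  obtain ⟨θ, i, hi⟩ := hd.2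
  exact ⟨θ, sum_lt_sum (fun i _ => hd.1 θ i) ⟨i, mem_univ i, hi⟩⟩

/-- In an individually undominated mechanism the surplus gets arbitrarily small as the type of
agent `0` varies: otherwise a fixed amount could be returned to that agent whenever the others
report `x`. -/
theorem IndividuallyUndominated.exists_sum_lt [Nonempty Θ] {v : Fin (N + 1) → D → Θ → ℝ}
    {M : Mechanism (N + 1) D Θ} (hM : IndividuallyUndominated v M) (x : Fin N → Θ) {ε : ℝ}
    (hε : 0 < ε) : ∃ y : Θ, ∑ i, M.t (Fin.cons y x) i < ε := by
  classical
  by_contra! hcon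
  obtain ⟨⟨hG, hN⟩, hU⟩ := hM
  obtain ⟨hE, h, hh⟩ := hG
  let bump : (Fin (N + 1) → Θ) → Fin (N + 1) → ℝ := fun θ i =>
    if i = 0 ∧ Fin.removeNth i θ = x then ε else 0
  have hbump : ∀ θ i, 0 ≤ bump θ i := fun θ i => by
    simp only [bump]; split_ifs <;> linarith
  have hu : ∀ θ i, utility v ⟨M.f, fun θ i => M.t θ i - bump θ i⟩ θ i
      = utility v M θ i + bump θ i := fun θ i => by simp only [utility]; ring
  refine hU ⟨M.f, fun θ i => M.t θ i - bump θ i⟩ ⟨⟨hE, fun i y => h i y -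
    if i = 0 ∧ y = x then ε else 0, fun θ i => ?_⟩, fun θ => ?_⟩ ⟨fun θ i => ?_, ?_⟩
  · simp only [bump, hh]; ring
  · simp only [sum_sub_distrib]
    by_cases hx : Fin.removeNth (0 : Fin (N + 1)) θ = x
    · have h1 : ∑ i, bump θ i = ε := by
        rw [sum_eq_single 0]
        · simp [bump, hx]
        · intro b _ hb; simp [bump, hb]
        · simp
      have h2 : (Fin.cons (θ 0) x : Fin (N + 1) → Θ) = θ := by
        rw [← hx]
        funext l
        refine Fin.cases ?_ (fun l => ?_) l <;> simp [Fin.tail]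
      have := hcon (θ 0)
      rw [h2] at this
      linarith
    · have h1 : ∑ i, bump θ i = 0 := sum_eq_zero fun i _ => by
        simp only [bump]
        rw [if_neg]
        rintro ⟨rfl, h⟩
        exact hx h
      have := hN θ
      linarith
  · rw [hu]; linarith [hbump θ i]
  · obtain ⟨y⟩ := ‹Nonempty Θ›
    refine ⟨Fin.cons y x, 0, ?_⟩
    have h2 : Fin.removeNth (0 : Fin (N + 1)) (Fin.cons y x : Fin (N + 1) → Θ) = x := by
      funext l; simp [Fin.removeNth_apply]
    have : bump (Fin.cons y x) 0 = ε := by simp only [bump, h2]; simp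
    rw [hu, this]
    linarith

theorem Efficient.welfare_eq {v : Fin (N + 1) → D → Θ → ℝ} {f f' : (Fin (N + 1) → Θ) → D}
    (hf : Efficient v f) (hf' : Efficient v f') (θ : Fin (N + 1) → Θ) :
    ∑ i, v i (f θ) (θ i) = ∑ i, v i (f' θ) (θ i) :=
  le_antisymm (hf' θ _) (hf θ _)

/-- The criterion for being undominated. Here `M` has a balanced budget on all rearrangements of
the profiles in `Z`, and a symmetric `φ` whose deletion sums vanish on `Z` is zero. The gain of a
dominating mechanism is a nonnegative sum of functions of the deleted profiles; it is zero where
`M` is balanced, so that its symmetrization, and hence the gain itself, is zero. -/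
theorem collectivelyUndominated_of_balanced {v : Fin (N + 1) → D → Θ → ℝ}
    {M : Mechanism (N + 1) D Θ} (hM : IsGroves v M) (hN : NonDeficit M)
    (Z : Set (Fin (N + 1) → Θ))
    (hZ : ∀ θ ∈ Z, ∀ σ : Equiv.Perm (Fin (N + 1)), ∑ i, M.t (θ ∘ σ) i = 0)
    (hsymm : ∀ φ : (Fin N → Θ) → ℝ, (∀ x (π : Equiv.Perm (Fin N)), φ (x ∘ π) = φ x) →
      (∀ θ ∈ Z, ∑ i, φ (Fin.removeNth i θ) = 0) → ∀ x, φ x = 0) :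
    CollectivelyUndominated v M := by
  refine ⟨⟨hM, hN⟩, ?_⟩
  rintro M' ⟨⟨hE', h', hh'⟩, hN'⟩ ⟨hle, θ₀, hlt⟩
  obtain ⟨hE, h, hh⟩ := hM
  let g : Fin (N + 1) → (Fin N → Θ) → ℝ := fun i x => h i x - h' i x
  have hg : ∀ θ : Fin (N + 1) → Θ, ∑ i, g i (Fin.removeNth i θ) =
      ∑ i, utility v M' θ i - ∑ i, utility v M θ i := by
    intro θ
    rw [← sum_sub_distrib]
    refine sum_congr rfl fun i _ => ?_
    rw [utility_eq_of_groves hh, utility_eq_of_groves hh', hE.welfare_eq hE']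
    simp only [g]; ring
  have hg0 : ∀ θ : Fin (N + 1) → Θ, 0 ≤ ∑ i, g i (Fin.removeNth i θ) := fun θ => by
    rw [hg]; linarith [hle θ]
  have hgZ : ∀ θ, ∑ i, M.t θ i = 0 → ∑ i, g i (Fin.removeNth i θ) = 0 := fun θ hθ => by
    refine le_antisymm ?_ (hg0 θ)
    rw [hg, sum_utility, sum_utility, hE.welfare_eq hE' θ, hθ]
    linarith [hN' θ]
  have hs := hsymm (symmetrized g) (symmetrized_comp_perm g) fun θ hθ => by
    rw [← sum_perm_sum_removeNth]
    exact sum_eq_zero fun σ _ => hgZ _ (hZ θ hθ σ)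
  have hsum := sum_perm_sum_removeNth g θ₀
  simp only [hs, sum_const_zero] at hsum
  have := (sum_eq_zero_iff_of_nonneg fun (σ : Equiv.Perm (Fin (N + 1))) _ =>
    hg0 (θ₀ ∘ σ)).1 hsum 1 (mem_univ _)
  have h1 : θ₀ ∘ ((1 : Equiv.Perm (Fin (N + 1))) : Fin (N + 1) → Fin (N + 1)) = θ₀ := rfl
  rw [h1, hg] at this
  linarith

end Groves

/-! ### Order statistics -/

section OrderStatistics

variable {n N : ℕ} {L U : ℝ}

theorem nthHighest_comp_perm (x : Fin n → Bid L U) (π : Equiv.Perm (Fin n)) (j : Fin n) :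
    nthHighest (x ∘ π) j = nthHighest x j :=
  congrFun (Tuple.comp_perm_comp_sort_eq_comp_sort (f := x) (σ := π)) j.rev

theorem nthHighest_of_antitone {x : Fin n → Bid L U} (hx : Antitone x) (j : Fin n) :
    nthHighest x j = x j := by
  have h : x ∘ (Fin.revPerm : Equiv.Perm (Fin n)) = x ∘ Tuple.sort x := by
    rw [Tuple.comp_sort_eq_comp_iff_monotone]
    intro a b hab
    exact hx (by simpa using Fin.rev_le_rev.2 hab)
  have := congrFun h j.rev
  simp only [Function.comp_apply, Fin.revPerm_apply, Fin.rev_rev] at this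
  exact this.symm

/-- A permutation that sorts `x` in decreasing order. -/
noncomputable def sortDesc (x : Fin n → Bid L U) : Equiv.Perm (Fin n) :=
  Fin.revPerm.trans (Tuple.sort x)

theorem nthHighest_eq_sortDesc (x : Fin n → Bid L U) (j : Fin n) :
    nthHighest x j = x (sortDesc x j) := rfl

theorem antitone_sortDesc (x : Fin n → Bid L U) : Antitone (x ∘ sortDesc x) := by
  intro a b hab
  exact Tuple.monotone_sort x (Fin.rev_le_rev.2 hab)

/-- The decreasing sequence `U, [x]₁, …, [x]ₙ, L, L, …`: the order statistics of `x`, extended by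
the ends of the type interval. Inserting a type into a profile then always falls between two
neighbours. -/
noncomputable def topSeq (x : Fin n → Bid L U) : ℕ → ℝ
  | 0 => U
  | j + 1 => if h : j < n then ((nthHighest x ⟨j, h⟩ : Bid L U) : ℝ) else L

theorem topSeq_zero (x : Fin n → Bid L U) : topSeq x 0 = U := rfl

theorem topSeq_succ (x : Fin n → Bid L U) {j : ℕ} (h : j < n) :
    topSeq x (j + 1) = x (sortDesc x ⟨j, h⟩) := by simp [topSeq, h, nthHighest_eq_sortDesc]

theorem topSeq_last (x : Fin n → Bid L U) : topSeq x (n + 1) = L := by simp [topSeq]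

theorem topSeq_comp_perm (x : Fin n → Bid L U) (π : Equiv.Perm (Fin n)) :
    topSeq (x ∘ π) = topSeq x := by
  funext j
  cases j with
  | zero => rfl
  | succ j => simp [topSeq, nthHighest_comp_perm]

theorem le_topSeq {x : Fin n → Bid L U} {v : ℝ} (hv : v ≤ U) {j : ℕ}
    (hj : j ≤ (univ.filter fun i => v ≤ (x i : ℝ)).card) : v ≤ topSeq x j := by
  cases j with
  | zero => exact hv
  | succ q =>
    have hq : q < n := lt_of_lt_of_le hj (by simpa using card_filter_le univ fun i => v ≤ (x i : ℝ))
    rw [topSeq_succ x hq]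
    by_contra! hlt
    have hsub : (univ.filter fun i => v ≤ (x i : ℝ)) ⊆
        (Iio (⟨q, hq⟩ : Fin n)).map (sortDesc x).toEmbedding := by
      intro i hi
      rw [mem_map]
      refine ⟨(sortDesc x).symm i, ?_, by simp⟩
      rw [mem_Iio]
      by_contra! hle
      have h1 : x i ≤ x (sortDesc x ⟨q, hq⟩) := by
        simpa using antitone_sortDesc x hle
      have h2 : (x i : ℝ) ≤ x (sortDesc x ⟨q, hq⟩) := h1
      have h3 : v ≤ (x i : ℝ) := by simpa using hi
      linarith
    have := card_le_card hsub
    rw [card_map, Fin.card_Iio] at this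
    simp only at this
    omega

theorem topSeq_le {x : Fin n → Bid L U} {v : ℝ} (hv : L ≤ v) {j : ℕ}
    (hj : n + 1 ≤ j + (univ.filter fun i => (x i : ℝ) ≤ v).card) : topSeq x j ≤ v := by
  have hcard : (univ.filter fun i => (x i : ℝ) ≤ v).card ≤ n := by
    simpa using card_filter_le univ fun i => (x i : ℝ) ≤ v
  obtain _ | q := j
  · omega
  by_cases hq : q < n
  · rw [topSeq_succ x hq]
    by_contra! hlt
    have hsub : (univ.filter fun i => (x i : ℝ) ≤ v) ⊆
        (Ioi (⟨q, hq⟩ : Fin n)).map (sortDesc x).toEmbedding := by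
      intro i hi
      rw [mem_map]
      refine ⟨(sortDesc x).symm i, ?_, by simp⟩
      rw [mem_Ioi]
      by_contra! hle
      have h1 : x (sortDesc x ⟨q, hq⟩) ≤ x i := by
        simpa using antitone_sortDesc x hle
      have h2 : (x (sortDesc x ⟨q, hq⟩) : ℝ) ≤ x i := h1
      have h3 : (x i : ℝ) ≤ v := by simpa using hi
      linarith
    have := card_le_card hsub
    rw [card_map, Fin.card_Ioi] at this
    simp only at this
    omega
  · simpa [topSeq, hq] using hv

theorem topSeq_mem (hLU : L ≤ U) (x : Fin n → Bid L U) (j : ℕ) :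
    L ≤ topSeq x j ∧ topSeq x j ≤ U := by
  obtain _ | q := j
  · exact ⟨hLU, le_rfl⟩
  by_cases hq : q < n
  · rw [topSeq_succ x hq]
    exact (x _).2
  · simp [topSeq, hq, hLU]

theorem topSeq_succ_le (hLU : L ≤ U) (x : Fin n → Bid L U) (j : ℕ) :
    topSeq x (j + 1) ≤ topSeq x j := by
  obtain _ | q := j
  · exact (topSeq_mem hLU x 1).2
  by_cases hq : q + 1 < n
  · rw [topSeq_succ x hq, topSeq_succ x (by omega : q < n)]
    have := antitone_sortDesc x (show (⟨q, by omega⟩ : Fin n) ≤ ⟨q + 1, hq⟩ from by simp)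
    exact this
  · have : topSeq x (q + 1 + 1) = L := by simp [topSeq, hq]
    rw [this]
    exact (topSeq_mem hLU x _).1

/-- The sum of a linear rule over all deletions of `θ`: the `j`-th highest of the other types is
`[θ]ⱼ` for the `n - j` agents ranked below `j`, and `[θ]ⱼ₊₁` for the others. -/
theorem sum_linearRule_removeNth (c : ℕ → ℝ) (θ : Fin (N + 1) → Bid L U) :
    ∑ i, linearRule c (Fin.removeNth i θ) = (N + 1) * c 0 + ∑ j ∈ range N,
      c (j + 1) * ((N - j) * topSeq θ (j + 1) + (j + 1) * topSeq θ (j + 2)) := by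
  have hsymm : ∀ (x : Fin N → Bid L U) (π : Equiv.Perm (Fin N)),
      linearRule c (x ∘ π) = linearRule c x := fun x π => by
    simp [linearRule, nthHighest_comp_perm]
  rw [← sum_removeNth_comp_perm hsymm θ (sortDesc θ)]
  have hanti := antitone_sortDesc θ
  set s := θ ∘ sortDesc θ with hs
  have h1 : ∀ i : Fin (N + 1), linearRule c (Fin.removeNth i s) =
      c 0 + ∑ j : Fin N, c (j + 1) * (s (i.succAbove j) : ℝ) := fun i => by
    have : Antitone (Fin.removeNth i s) := fun a b hab =>
      hanti ((Fin.strictMono_succAbove i).monotone hab)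
    simp [linearRule, nthHighest_of_antitone this, Fin.removeNth_apply]
  simp only [h1, sum_add_distrib, sum_const, card_univ, Fintype.card_fin, nsmul_eq_mul]
  rw [sum_comm, ← Fin.sum_univ_eq_sum_range (fun j =>
    c (j + 1) * ((N - j) * topSeq θ (j + 1) + (j + 1) * topSeq θ (j + 2)))]
  push_cast
  congr 1
  refine sum_congr rfl fun j _ => ?_
  rw [← mul_sum]
  congr 1
  have h2 : ∀ i : Fin (N + 1), (s (i.succAbove j) : ℝ) =
      if j.castSucc < i then (s j.castSucc : ℝ) else (s j.succ : ℝ) := fun i => by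
    rw [Fin.succAbove]; split_ifs <;> rfl
  simp only [h2, sum_ite, sum_const, nsmul_eq_mul]
  have h3 : (univ.filter fun i => j.castSucc < i).card = N - j := by
    rw [show (univ.filter fun i => j.castSucc < i) = Ioi j.castSucc by ext; simp, Fin.card_Ioi]
    simp
  have h4 : (univ.filter fun i => ¬ j.castSucc < i).card = j + 1 := by
    rw [show (univ.filter fun i => ¬ j.castSucc < i) = Iic j.castSucc by ext; simp, Fin.card_Iic]
    simp
  rw [h3, h4, topSeq_succ θ (by omega : (j : ℕ) < N + 1),
    topSeq_succ θ (by omega : (j : ℕ) + 1 < N + 1), Nat.cast_sub j.2.le]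
  push_cast
  rfl

end OrderStatistics

/-! ### The revenue of the VCG mechanism -/

section Revenue

variable {n N m : ℕ} {L U : ℝ}

theorem sum_auctionValue (A : Finset (Fin n)) (d : Allocation n m) (θ : Fin n → Bid L U) :
    ∑ j ∈ A, auctionValue n m L U j d (θ j) = ∑ j ∈ A ∩ d.1, (θ j : ℝ) := by
  simp [auctionValue, sum_ite_mem]

/-- A set `S` of at most `m` elements weighs at most `m * τ` plus the excess over the threshold `τ`
of a set `T` that contains all elements of `S` heavier than `τ`. This bounds the welfare of every
allocation, with or without one agent. -/
theorem sum_le_of_threshold {ι : Type*} [DecidableEq ι] {S T : Finset ι} {w : ι → ℝ} {τ : ℝ}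
    (hτ : 0 ≤ τ) (hS : S.card ≤ m) (hT : ∀ i ∈ T, τ ≤ w i) (hST : ∀ i ∈ S, i ∉ T → w i ≤ τ) :
    ∑ i ∈ S, w i ≤ m * τ + ∑ i ∈ T, (w i - τ) := by
  have h1 : ∑ i ∈ S, (w i - τ) ≤ ∑ i ∈ T, (w i - τ) := by
    rw [← sum_inter_add_sum_sdiff S T]
    have h2 : ∑ i ∈ S \ T, (w i - τ) ≤ 0 := sum_nonpos fun i hi => by
      have := hST i (mem_sdiff.1 hi).1 (mem_sdiff.1 hi).2; linarith
    have h3 : ∑ i ∈ S ∩ T, (w i - τ) ≤ ∑ i ∈ T, (w i - τ) :=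
      sum_le_sum_of_subset_of_nonneg inter_subset_right fun i hi _ => by
        have := hT i hi; linarith
    linarith
  rw [sum_sub_distrib, sum_const, nsmul_eq_mul] at h1
  have h4 : (S.card : ℝ) * τ ≤ m * τ := by gcongr
  linarith

/-- Here `T` is the set of the `m` highest bidders and `τ` is the highest bid outside `T`. The payments
are computed from the welfare alone, since ties leave the winners undetermined. -/
theorem sum_vcgPayment_of_threshold {f : (Fin (N + 1) → Bid L U) → Allocation (N + 1) m}
    (hf : Efficient (auctionValue (N + 1) m L U) f) (θ : Fin (N + 1) → Bid L U)
    {T : Finset (Fin (N + 1))} {τ : ℝ} (hcard : T.card = m) (hτ : 0 ≤ τ)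
    (hT : ∀ i ∈ T, τ ≤ θ i) (hT' : ∀ i ∉ T, (θ i : ℝ) ≤ τ) {i₀ : Fin (N + 1)} (hi₀ : i₀ ∉ T)
    (hi₀τ : (θ i₀ : ℝ) = τ) :
    ∑ i, vcgPayment (auctionValue (N + 1) m L U) f θ i = m * τ := by
  set E : ℝ := ∑ j ∈ T, (θ j : ℝ) with hE
  have hwel : ∑ i, auctionValue (N + 1) m L U i (f θ) (θ i) = E := by
    refine le_antisymm ?_ ?_
    · rw [sum_auctionValue, univ_inter]
      refine (sum_le_of_threshold hτ (f θ).2 hT fun i _ hi => hT' i hi).trans ?_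
      simp [sum_sub_distrib, hcard, hE]
    · refine le_trans ?_ (hf θ ⟨T, hcard.le⟩)
      rw [sum_auctionValue, univ_inter]
  have hW : ∀ i, (⨆ d : Allocation (N + 1) m,
      ∑ j ∈ univ.erase i, auctionValue (N + 1) m L U j d (θ j)) =
        E - if i ∈ T then (θ i : ℝ) - τ else 0 := by
    intro i
    have : Nonempty (Allocation (N + 1) m) := ⟨⟨∅, by simp⟩⟩
    have hval : m * τ + ∑ j ∈ T.erase i, ((θ j : ℝ) - τ) =
        E - if i ∈ T then (θ i : ℝ) - τ else 0 := by
      have : ∑ j ∈ T, ((θ j : ℝ) - τ) = E - m * τ := by simp [sum_sub_distrib, hcard, hE]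
      split_ifs with hi
      · have h := add_sum_erase T (fun j => (θ j : ℝ) - τ) hi
        linarith
      · rw [erase_eq_of_notMem hi]; linarith
    refine le_antisymm (ciSup_le fun d => ?_) ?_
    · rw [sum_auctionValue, ← hval]
      refine sum_le_of_threshold hτ ((card_le_card inter_subset_right).trans d.2)
        (fun j hj => hT j (mem_of_mem_erase hj)) fun j hj hj' => hT' j fun hjT => hj' ?_
      exact mem_erase.2 ⟨(mem_erase.1 (mem_inter.1 hj).1).1, hjT⟩
    · by_cases hi : i ∈ T
      · have hne : i₀ ∉ T.erase i := fun h => hi₀ (mem_of_mem_erase h)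
        refine le_trans ?_ (le_ciSup (Set.finite_range _).bddAbove
          (⟨insert i₀ (T.erase i), ?_⟩ : Allocation (N + 1) m))
        · rw [sum_auctionValue]
          have h1 : univ.erase i ∩ insert i₀ (T.erase i) = insert i₀ (T.erase i) := by
            rw [inter_eq_right]
            intro j hj
            rcases mem_insert.1 hj with rfl | hj
            · exact mem_erase.2 ⟨fun h => hi₀ (h ▸ hi), mem_univ _⟩
            · exact mem_erase.2 ⟨(mem_erase.1 hj).1, mem_univ _⟩
          simp only [h1, if_pos hi]
          rw [sum_insert hne, hi₀τ]
          have h := add_sum_erase T (fun j => (θ j : ℝ)) hi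
          linarith
        · rw [card_insert_of_notMem hne, card_erase_add_one hi, hcard]
      · refine le_trans ?_ (le_ciSup (Set.finite_range _).bddAbove
          (⟨T, hcard.le⟩ : Allocation (N + 1) m))
        rw [sum_auctionValue]
        have h1 : univ.erase i ∩ T = T := by
          rw [inter_eq_right]
          exact fun j hj => mem_erase.2 ⟨fun h => hi (h ▸ hj), mem_univ _⟩
        simp [h1, hi, hE]
  have hpay : ∀ i, vcgPayment (auctionValue (N + 1) m L U) f θ i =
      auctionValue (N + 1) m L U i (f θ) (θ i) - if i ∈ T then (θ i : ℝ) - τ else 0 := by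
    intro i
    rw [vcgPayment, hW]
    have := add_sum_erase univ (fun j => auctionValue (N + 1) m L U j (f θ) (θ j)) (mem_univ i)
    linarith
  simp only [hpay, sum_sub_distrib, hwel, sum_ite_mem, univ_inter, sum_const, hcard, nsmul_eq_mul]
  rw [← hE]
  ring

/-- The VCG mechanism charges each of the `m` winners the highest losing bid. -/
theorem sum_vcgPayment (hL : 0 ≤ L) (hmn : m < N + 1)
    {f : (Fin (N + 1) → Bid L U) → Allocation (N + 1) m}
    (hf : Efficient (auctionValue (N + 1) m L U) f) (θ : Fin (N + 1) → Bid L U) :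
    ∑ i, vcgPayment (auctionValue (N + 1) m L U) f θ i = m * topSeq θ (m + 1) := by
  rw [topSeq_succ θ hmn]
  have hanti := antitone_sortDesc θ
  refine sum_vcgPayment_of_threshold hf θ
    (T := (Iio (⟨m, hmn⟩ : Fin (N + 1))).map (sortDesc θ).toEmbedding)
    (i₀ := sortDesc θ ⟨m, hmn⟩) (by simp) (hL.trans (θ _).2.1) ?_ ?_ (by simp) rfl
  · intro i hi
    obtain ⟨j, hj, rfl⟩ := mem_map.1 hi
    exact hanti (mem_Iio.1 hj).le
  · intro i hi
    have h : ⟨m, hmn⟩ ≤ (sortDesc θ).symm i := by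
      by_contra! h
      exact hi (mem_map.2 ⟨_, mem_Iio.2 h, by simp⟩)
    have h2 : (θ ∘ sortDesc θ) ((sortDesc θ).symm i) ≤ (θ ∘ sortDesc θ) ⟨m, hmn⟩ := hanti h
    simpa using h2

end Revenue

/-! ### The surplus in barycentric coordinates -/

/-- The coefficient of the `(j + 1)`-th highest type in the surplus of the mechanism with
redistribution rule `linearRule c`. -/
noncomputable def surplusCoeff (N m : ℕ) (c : ℕ → ℝ) (j : ℕ) : ℝ :=
  (if j = m then (m : ℝ) else 0) - (N - j) * c (j + 1) - j * c j

/-- The surplus at the vertex of the simplex `U ≥ t₁ ≥ ⋯ ≥ tₙ ≥ L` at which the `k` highest types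
are `U` and the others are `L`. -/
noncomputable def vertexSurplus (N m : ℕ) (L U : ℝ) (c : ℕ → ℝ) (k : ℕ) : ℝ :=
  -((N + 1) * c 0) + L * ∑ j ∈ range (N + 1), surplusCoeff N m c j +
    (U - L) * ∑ j ∈ range k, surplusCoeff N m c j

/-- The surplus as a function of the decreasing sequence of types. -/
noncomputable def surplus (N m : ℕ) (c : ℕ → ℝ) (t : ℕ → ℝ) : ℝ :=
  -((N + 1) * c 0) + ∑ j ∈ range (N + 1), surplusCoeff N m c j * t (j + 1)

section Surplus

variable {N m : ℕ} {L U : ℝ}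

theorem surplus_eq (hmn : m < N + 1) (c t : ℕ → ℝ) :
    surplus N m c t = m * t (m + 1) - ((N + 1) * c 0 + ∑ j ∈ range N,
      c (j + 1) * ((N - j) * t (j + 1) + (j + 1) * t (j + 2))) := by
  have h1 : ∑ j ∈ range (N + 1), (if j = m then (m : ℝ) else 0) * t (j + 1) = m * t (m + 1) := by
    simp [ite_mul, sum_ite_eq', hmn]
  have h2 : ∑ j ∈ range (N + 1), (N - j) * c (j + 1) * t (j + 1) =
      ∑ j ∈ range N, ((N : ℝ) - j) * c (j + 1) * t (j + 1) := by
    rw [sum_range_succ]; simp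
  have h3 : ∑ j ∈ range (N + 1), (j : ℝ) * c j * t (j + 1) =
      ∑ j ∈ range N, ((j : ℝ) + 1) * c (j + 1) * t (j + 2) := by
    rw [sum_range_succ']; simp
  have h4 : ∑ j ∈ range N, c (j + 1) * (((N : ℝ) - j) * t (j + 1) + (j + 1) * t (j + 2)) =
      ∑ j ∈ range N, ((N : ℝ) - j) * c (j + 1) * t (j + 1) +
      ∑ j ∈ range N, ((j : ℝ) + 1) * c (j + 1) * t (j + 2) := by
    rw [← sum_add_distrib]; exact sum_congr rfl fun j _ => by ring
  simp only [surplus, surplusCoeff, sub_mul, sum_sub_distrib] at *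
  rw [h1, h4]
  linarith

theorem sum_surplusCoeff (hmn : m < N + 1) (c : ℕ → ℝ) :
    ∑ j ∈ range (N + 1), surplusCoeff N m c j = m - (N + 1) * ∑ j ∈ range N, c (j + 1) := by
  have h := surplus_eq hmn c fun _ => 1
  have h4 : ∑ j ∈ range N, c (j + 1) * (((N : ℝ) - j) * 1 + (j + 1) * 1) =
      (N + 1) * ∑ j ∈ range N, c (j + 1) := by
    rw [mul_sum]; exact sum_congr rfl fun j _ => by ring
  simp only [surplus, mul_one] at h
  simp only [mul_one] at h4
  rw [h4] at h
  linarith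

theorem sum_range_mul_sub (b t : ℕ → ℝ) (M : ℕ) :
    ∑ k ∈ range (M + 1), (∑ j ∈ range k, b j) * (t k - t (k + 1)) =
      ∑ j ∈ range M, b j * t (j + 1) - (∑ j ∈ range M, b j) * t (M + 1) := by
  induction M with
  | zero => simp
  | succ M ih => rw [sum_range_succ, ih]; simp only [sum_range_succ]; ring

/-- The surplus is the affine interpolation of its values at the vertices; the barycentric
coordinates are the gaps between consecutive types, up to the factor `U - L`. -/
theorem mul_surplus_eq (c : ℕ → ℝ) {t : ℕ → ℝ} (h0 : t 0 = U) (hlast : t (N + 2) = L) :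
    (U - L) * surplus N m c t =
      ∑ k ∈ range (N + 2), vertexSurplus N m L U c k * (t k - t (k + 1)) := by
  have h1 := sum_range_mul_sub (surplusCoeff N m c) t (N + 1)
  have h2 : ∑ k ∈ range (N + 2), (t k - t (k + 1)) = U - L := by
    rw [sum_range_sub', h0, hlast]
  have h3 : ∑ k ∈ range (N + 2), vertexSurplus N m L U c k * (t k - t (k + 1)) =
      (-((N + 1) * c 0) + L * ∑ j ∈ range (N + 1), surplusCoeff N m c j) *
        ∑ k ∈ range (N + 2), (t k - t (k + 1)) +
      (U - L) * ∑ k ∈ range (N + 2),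
        (∑ j ∈ range k, surplusCoeff N m c j) * (t k - t (k + 1)) := by
    simp only [vertexSurplus, add_mul, sum_add_distrib, mul_sum (range (N + 2)), mul_assoc]
  rw [h3, h1, h2, hlast, surplus]
  ring

theorem surplus_vertex (c : ℕ → ℝ) {t : ℕ → ℝ} {k : ℕ} (hk : k ≤ N + 1)
    (hU : ∀ j ≤ k, t j = U) (hL : ∀ j, k < j → t j = L) :
    surplus N m c t = vertexSurplus N m L U c k := by
  have h1 : ∀ j ∈ range k, surplusCoeff N m c j * t (j + 1) = surplusCoeff N m c j * U :=
    fun j hj => by rw [hU (j + 1) (by simpa using hj)]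
  have h2 : ∀ j ∈ Ico k (N + 1), surplusCoeff N m c j * t (j + 1) = surplusCoeff N m c j * L :=
    fun j hj => by rw [hL (j + 1) (by have := mem_Ico.1 hj; omega)]
  rw [surplus, vertexSurplus, ← sum_range_add_sum_Ico _ hk, ← sum_range_add_sum_Ico _ hk,
    sum_congr rfl h1, sum_congr rfl h2, ← sum_mul, ← sum_mul]
  ring

/-- The total payment depends on the type profile only through its order statistics. -/
theorem sum_payment_eq_surplus (hL : 0 ≤ L) (hmn : m < N + 1)
    {M : Mechanism (N + 1) (Allocation (N + 1) m) (Bid L U)}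
    (hM : IsGroves (auctionValue (N + 1) m L U) M) {c : ℕ → ℝ}
    (hc : HasRedistribution (auctionValue (N + 1) m L U) M fun _ => linearRule c)
    (θ : Fin (N + 1) → Bid L U) : ∑ i, M.t θ i = surplus N m c (topSeq θ) := by
  have h : ∀ i, M.t θ i = vcgPayment (auctionValue (N + 1) m L U) M.f θ i -
    linearRule c (Fin.removeNth i θ) := hc θ
  simp only [h, sum_sub_distrib]
  rw [sum_vcgPayment hL hmn hM.1, sum_linearRule_removeNth, surplus_eq hmn]

end Surplus

/-! ### Recurrences for the coefficients -/

section Recurrence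

variable {N m k : ℕ}

theorem oelLow_self (hmn : m < N + 1) : oelLow (N + 1) m m = 1 := by
  have : N + 1 - m - 1 = N - m := by omega
  simp [oelLow, ← two_mul]

theorem oelLow_succ {j : ℕ} (hj : 1 ≤ j) (hjm : j < m) (hmn : m < N + 1) :
    (N - j) * oelLow (N + 1) m (j + 1) + j * oelLow (N + 1) m j = 0 := by
  obtain ⟨i, rfl⟩ : ∃ i, j = i + 1 := ⟨j - 1, by omega⟩
  obtain ⟨d, rfl⟩ : ∃ d, m = i + d + 2 := ⟨m - i - 2, by omega⟩
  obtain ⟨e, rfl⟩ : ∃ e, N = i + d + 2 + e := ⟨N - (i + d + 2), by omega⟩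
  have h1 : ((d + e).choose e : ℝ) * (d + e + 1) = (d + e + 1).choose e * (d + 1) := by
    have := Nat.choose_mul_succ_eq (d + e) e
    rw [show d + e + 1 - e = d + 1 by omega] at this
    exact_mod_cast this
  have h2 : ((i + d + 1).choose (i + 1) : ℝ) * (i + 1) = (i + d + 1).choose i * (d + 1) := by
    have := Nat.choose_succ_right_eq (i + d + 1) i
    rw [show i + d + 1 - i = d + 1 by omega] at this
    exact_mod_cast this
  have h3 : ((i + d + 1).choose (i + 1) : ℝ) ≠ 0 := by
    exact_mod_cast (Nat.choose_pos (by omega)).ne'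
  have h4 : ((i + d + 1).choose i : ℝ) ≠ 0 := by
    exact_mod_cast (Nat.choose_pos (by omega)).ne'
  have h5 : (-1 : ℝ) ^ (i + d + 2 + (i + 1 + 1)) = -(-1) ^ (i + d + 2 + (i + 1)) := by
    rw [← add_assoc, pow_succ]; ring
  simp only [oelLow, show i + d + 2 + e + 1 - (i + 1 + 1) - 1 = d + e by omega,
    show i + d + 2 + e + 1 - (i + d + 2) - 1 = e by omega, show i + d + 2 - 1 = i + d + 1 by omega,
    show i + d + 2 + e + 1 - (i + 1) - 1 = d + e + 1 by omega,
    show i + 1 + 1 - 1 = i + 1 by omega, show i + 1 - 1 = i by omega]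
  rw [h5]
  push_cast
  field_simp
  linear_combination (-(-1) ^ (i + d + 2 + (i + 1)) * ((i + d + 1).choose i : ℝ)) * h1
    + ((-1) ^ (i + d + 2 + (i + 1)) * ((d + e + 1).choose e : ℝ)) * h2

theorem oelHigh_first (hm : 1 ≤ m) (hmN : m < N) :
    (N - m) * oelHigh (N + 1) m (m + 1) = m := by
  obtain ⟨i, rfl⟩ : ∃ i, m = i + 1 := ⟨m - 1, by omega⟩
  obtain ⟨e, rfl⟩ : ∃ e, N = i + 2 + e := ⟨N - i - 2, by omega⟩
  have h1 : (-1 : ℝ) ^ (i + 1 + (i + 1 + 1) + 1) = 1 := Even.neg_one_pow ⟨i + 2, by ring⟩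
  simp only [oelHigh, h1, show i + 2 + e + 1 - (i + 1) - 1 = e + 1 by omega,
    show i + 2 + e + 1 - (i + 1 + 1) - 1 = e by omega, show i + 1 + 1 - 1 = i + 1 by omega,
    show i + 1 - 1 = i by omega, Nat.choose_succ_self_right]
  push_cast
  have : (e : ℝ) + 1 ≠ 0 := by positivity
  field_simp
  ring

theorem oelHigh_succ {j : ℕ} (hm : 1 ≤ m) (hmj : m < j) (hjN : j < N) :
    (N - j) * oelHigh (N + 1) m (j + 1) + j * oelHigh (N + 1) m j = 0 := by
  obtain ⟨i, rfl⟩ : ∃ i, m = i + 1 := ⟨m - 1, by omega⟩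
  obtain ⟨d, rfl⟩ : ∃ d, j = i + d + 2 := ⟨j - i - 2, by omega⟩
  obtain ⟨e, rfl⟩ : ∃ e, N = i + d + 3 + e := ⟨N - (i + d + 3), by omega⟩
  have h1 : ((i + d + 1).choose i : ℝ) * (i + d + 2) = (i + d + 2).choose i * (d + 2) := by
    have := Nat.choose_mul_succ_eq (i + d + 1) i
    rw [show i + d + 1 + 1 - i = d + 2 by omega] at this
    exact_mod_cast this
  have h2 : ((d + 2 + e).choose (e + 1) : ℝ) * (e + 1) = (d + 2 + e).choose e * (d + 2) := by
    have := Nat.choose_succ_right_eq (d + 2 + e) e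
    rw [show d + 2 + e - e = d + 2 by omega] at this
    exact_mod_cast this
  have h3 : ((d + 2 + e).choose (e + 1) : ℝ) ≠ 0 := by
    exact_mod_cast (Nat.choose_pos (by omega)).ne'
  have h4 : ((d + 2 + e).choose e : ℝ) ≠ 0 := by
    exact_mod_cast (Nat.choose_pos (by omega)).ne'
  have h5 : (-1 : ℝ) ^ (i + 1 + (i + d + 2 + 1) + 1) = -(-1) ^ (i + 1 + (i + d + 2) + 1) := by
    rw [← add_assoc, pow_succ (-1 : ℝ) (i + 1 + (i + d + 2) + 1)]; ring
  simp only [oelHigh, h5, show i + d + 3 + e + 1 - (i + 1) - 1 = d + 2 + e by omega,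
    show i + d + 3 + e + 1 - (i + d + 2 + 1) - 1 = e by omega,
    show i + d + 3 + e + 1 - (i + d + 2) - 1 = e + 1 by omega,
    show i + d + 2 + 1 - 1 = i + d + 2 by omega, show i + d + 2 - 1 = i + d + 1 by omega,
    show i + 1 - 1 = i by omega]
  push_cast
  field_simp
  linear_combination (-1) ^ (i + 1 + (i + d + 2) + 1) * ((d + 2 + e).choose e : ℝ) * h1 -
    (-1) ^ (i + 1 + (i + d + 2) + 1) * ((i + d + 2).choose i : ℝ) * h2

theorem even_of_oelLow_nonneg {i : ℕ} (hi : 1 ≤ i) (him : i ≤ m) (hmn : m < N + 1)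
    (h : 0 ≤ oelLow (N + 1) m i) : Even (m + i) := by
  by_contra hodd
  rw [Nat.not_even_iff_odd] at hodd
  have h1 : (0 : ℝ) < (N + 1 - i - 1).choose (N + 1 - m - 1) := by
    exact_mod_cast Nat.choose_pos (by omega)
  have h2 : (0 : ℝ) < (m - 1).choose (i - 1) := by
    exact_mod_cast Nat.choose_pos (by omega)
  rw [oelLow, hodd.neg_one_pow, neg_one_mul, neg_div] at h
  have := div_pos h1 h2
  linarith

theorem even_of_oelHigh_nonpos {i : ℕ} (hm : 1 ≤ m) (hi : m < i) (hiN : i ≤ N)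
    (h : oelHigh (N + 1) m i ≤ 0) : Even (m + i) := by
  by_contra hodd
  rw [Nat.not_even_iff_odd] at hodd
  have h1 : (0 : ℝ) < (i - 1).choose (m - 1) := by
    exact_mod_cast Nat.choose_pos (by omega)
  have h2 : (0 : ℝ) < (N + 1 - m - 1).choose (N + 1 - i - 1) := by
    exact_mod_cast Nat.choose_pos (by omega)
  rw [oelHigh, hodd.add_one.neg_one_pow, one_mul] at h
  have := div_pos h1 h2
  linarith

/-- The values of the coefficients `c₁, …, c_N` other than `cₖ` in the mechanism of index `k`. -/
def HasOELShape (N m k : ℕ) (c : ℕ → ℝ) : Prop :=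
  (∀ i, 1 ≤ i → i ≤ N → k < i → i ≤ m → c i = oelLow (N + 1) m i) ∧
  (∀ i, 1 ≤ i → i ≤ N → m < i → i < k → c i = oelHigh (N + 1) m i) ∧
  (∀ i, 1 ≤ i → i ≤ N → i < k → i ≤ m → c i = 0) ∧
  (∀ i, 1 ≤ i → i ≤ N → k < i → m < i → c i = 0)

/-- The equations determine the coefficients away from `cₖ`: upwards from `c₁` below `k`, and
downwards from `c_N` above `k`. -/
theorem hasOELShape_of_surplusCoeff_eq_zero (hm : 1 ≤ m) (hmn : m < N + 1) {c : ℕ → ℝ}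
    (h : ∀ j < N + 1, j ≠ k → j + 1 ≠ k → surplusCoeff N m c j = 0) : HasOELShape N m k c := by
  have hlow0 : ∀ i, 1 ≤ i → i ≤ N → i < k → i ≤ m → c i = 0 := by
    intro i
    induction i with
    | zero => omega
    | succ j ih =>
      intro _ hjN hjk hjm
      have h1 := h j (by omega) (by omega) (by omega)
      rw [surplusCoeff, if_neg (by omega)] at h1
      have h2 : (j : ℝ) * c j = 0 := by
        rcases Nat.eq_zero_or_pos j with rfl | hj
        · simp
        · rw [ih hj (by omega) (by omega) (by omega), mul_zero]
      have h3 : (N : ℝ) - j ≠ 0 := by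
        have : (j : ℝ) + 1 ≤ N := by exact_mod_cast hjN
        linarith
      have h4 : ((N : ℝ) - j) * c (j + 1) = 0 := by linarith
      exact (mul_eq_zero.1 h4).resolve_left h3
  have hhigh0 : ∀ d i, i + d = N → 1 ≤ i → k < i → m < i → c i = 0 := by
    intro d
    induction d with
    | zero =>
      rintro i hi h1 hki hmi
      obtain rfl : i = N := by omega
      have h2 := h i (by omega) (by omega) (by omega)
      rw [surplusCoeff, if_neg (by omega), sub_self, zero_mul] at h2
      have h3 : (i : ℝ) * c i = 0 := by linarith
      exact (mul_eq_zero.1 h3).resolve_left (by positivity)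
    | succ d ih =>
      intro i hi h1 hki hmi
      have h2 := h i (by omega) (by omega) (by omega)
      rw [surplusCoeff, if_neg (by omega), ih (i + 1) (by omega) (by omega) (by omega) (by omega)]
        at h2
      have h3 : (i : ℝ) * c i = 0 := by linarith
      exact (mul_eq_zero.1 h3).resolve_left (by positivity)
  refine ⟨?_, ?_, hlow0, fun i h1 hiN => hhigh0 (N - i) i (by omega) h1⟩
  · suffices H : ∀ d i, i + d = m → 1 ≤ i → k < i → c i = oelLow (N + 1) m i from
      fun i h1 _ hki him => H (m - i) i (by omega) h1 hki
    intro d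
    induction d with
    | zero =>
      rintro i hi h1 hki
      obtain rfl : i = m := by omega
      have h2 := h i (by omega) (by omega) (by omega)
      have h3 : ((N : ℝ) - i) * c (i + 1) = 0 := by
        rcases eq_or_lt_of_le (Nat.lt_succ_iff.1 hmn) with rfl | hlt
        · simp
        · rw [hhigh0 (N - (i + 1)) (i + 1) (by omega) (by omega) (by omega) (by omega), mul_zero]
      rw [surplusCoeff, if_pos rfl, h3] at h2
      rw [oelLow_self hmn]
      have h4 : (i : ℝ) * (c i - 1) = 0 := by linarith
      have := (mul_eq_zero.1 h4).resolve_left (by positivity)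
      linarith
    | succ d ih =>
      intro i hi h1 hki
      have h2 := h i (by omega) (by omega) (by omega)
      rw [surplusCoeff, if_neg (by omega), ih (i + 1) (by omega) (by omega) (by omega)] at h2
      have h3 := oelLow_succ (N := N) h1 (by omega : i < m) hmn
      have h4 : (i : ℝ) * (c i - oelLow (N + 1) m i) = 0 := by linarith
      have := (mul_eq_zero.1 h4).resolve_left (by positivity)
      linarith
  · suffices H : ∀ d, m + 1 + d ≤ N → m + 1 + d < k →
        c (m + 1 + d) = oelHigh (N + 1) m (m + 1 + d) from fun i _ hiN hmi hik => by
      obtain ⟨d, rfl⟩ := Nat.exists_eq_add_of_lt hmi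
      have := H d (by omega) (by omega)
      rwa [show m + 1 + d = m + d + 1 by omega] at this
    intro d
    induction d with
    | zero =>
      intro hN hk
      have h2 := h m (by omega) (by omega) (by omega)
      rw [surplusCoeff, if_pos rfl, hlow0 m hm (by omega) (by omega) le_rfl] at h2
      have h3 := oelHigh_first (N := N) hm (by omega)
      have h4 : ((N : ℝ) - m) * (c (m + 1) - oelHigh (N + 1) m (m + 1)) = 0 := by linarith
      have h5 : (N : ℝ) - m ≠ 0 := by
        have : (m : ℝ) + 1 ≤ N := by exact_mod_cast hN
        linarith
      have := (mul_eq_zero.1 h4).resolve_left h5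
      simp only [add_zero]
      linarith
    | succ d ih =>
      intro hN hk
      rw [← add_assoc] at hN hk ⊢
      have h2 := h (m + 1 + d) (by omega) (by omega) (by omega)
      rw [surplusCoeff, if_neg (by omega), ih (by omega) (by omega)] at h2
      have h3 := oelHigh_succ (N := N) hm (by omega : m < m + 1 + d) (by omega)
      have h4 : ((N : ℝ) - (m + 1 + d : ℕ)) * (c (m + 1 + d + 1) -
          oelHigh (N + 1) m (m + 1 + d + 1)) = 0 := by linarith
      have h5 : (N : ℝ) - (m + 1 + d : ℕ) ≠ 0 := by
        have : ((m + 1 + d : ℕ) : ℝ) + 1 ≤ N := by exact_mod_cast hN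
        linarith
      have := (mul_eq_zero.1 h4).resolve_left h5
      linarith

theorem HasOELShape.surplusCoeff_eq_zero (hm : 1 ≤ m) (hmn : m < N + 1)
    (hk : k ≤ N + 1) {c : ℕ → ℝ} (h : HasOELShape N m k c) {j : ℕ} (hj : j < N + 1)
    (hjk : j ≠ k) (hjk' : j + 1 ≠ k) :
    surplusCoeff N m c j = 0 := by
  obtain ⟨hα, hβ, hlow, hhigh⟩ := h
  rw [surplusCoeff]
  rcases lt_or_gt_of_ne hjk with hlt | hgt
  · have hjk2 : j + 1 < k := by omega
    by_cases hjm : j < m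
    · rw [if_neg (by omega), hlow (j + 1) (by omega) (by omega) hjk2 hjm]
      rcases Nat.eq_zero_or_pos j with rfl | hj0
      · simp
      · rw [hlow j hj0 (by omega) hlt hjm.le]; simp
    · rcases eq_or_lt_of_le (not_lt.1 hjm) with rfl | hjm
      · rw [if_pos rfl, hlow m hm (by omega) hlt le_rfl]
        rw [hβ (m + 1) (by omega) (by omega) (by omega) hjk2, oelHigh_first hm (by omega)]
        ring
      · rw [if_neg (by omega), hβ j (by omega) (by omega) hjm hlt]
        rw [hβ (j + 1) (by omega) (by omega) (by omega) hjk2]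
        linarith [oelHigh_succ (N := N) hm hjm (by omega)]
  · have hN : ∀ hmj : m ≤ j, ((N : ℝ) - j) * c (j + 1) = 0 := by
      intro hmj
      rcases eq_or_lt_of_le (Nat.lt_succ_iff.1 hj) with rfl | hN
      · simp
      · rw [hhigh (j + 1) (by omega) (by omega) (by omega) (by omega), mul_zero]
    rcases lt_trichotomy j m with hjm | rfl | hjm
    · rw [if_neg (by omega), hα j (by omega) (by omega) hgt hjm.le,
        hα (j + 1) (by omega) (by omega) (by omega) hjm]
      linarith [oelLow_succ (N := N) (by omega : 1 ≤ j) hjm hmn]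
    · rw [if_pos rfl, hN le_rfl, hα j hm (by omega) hgt le_rfl, oelLow_self hmn]
      ring
    · rw [if_neg (by omega), hN hjm.le, hhigh j (by omega) (by omega) hgt hjm]
      ring

end Recurrence

/-! ### The coefficients for which the surplus is supported on one gap -/

section Characterization

variable {N m k : ℕ} {L U : ℝ}

theorem vertexSurplus_of_lt {c : ℕ → ℝ}
    (h : ∀ j < N + 1, j ≠ k → j + 1 ≠ k → surplusCoeff N m c j = 0) (hk : k ≤ N + 1) {j : ℕ}
    (hj : j < k) : vertexSurplus N m L U c j =
      -((N + 1) * c 0) + L * ∑ j ∈ range (N + 1), surplusCoeff N m c j := by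
  have : ∑ i ∈ range j, surplusCoeff N m c i = 0 := sum_eq_zero fun i hi => by
    have := mem_range.1 hi
    exact h i (by omega) (by omega) (by omega)
  rw [vertexSurplus, this]; ring

theorem vertexSurplus_of_gt {c : ℕ → ℝ}
    (h : ∀ j < N + 1, j ≠ k → j + 1 ≠ k → surplusCoeff N m c j = 0) {j : ℕ}
    (hj : k < j) (hjN : j ≤ N + 1) : vertexSurplus N m L U c j =
      -((N + 1) * c 0) + U * ∑ j ∈ range (N + 1), surplusCoeff N m c j := by
  have h1 : ∑ i ∈ Ico j (N + 1), surplusCoeff N m c i = 0 := sum_eq_zero fun i hi => by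
    have := mem_Ico.1 hi
    exact h i (by omega) (by omega) (by omega)
  have h2 := sum_range_add_sum_Ico (fun i => surplusCoeff N m c i) hjN
  rw [vertexSurplus, ← h2, h1]; ring

theorem vertexSurplus_succ_sub (c : ℕ → ℝ) (j : ℕ) :
    vertexSurplus N m L U c (j + 1) - vertexSurplus N m L U c j =
      (U - L) * surplusCoeff N m c j := by
  simp only [vertexSurplus, sum_range_succ _ j]; ring

theorem sum_coeff_of_shape_low {c : ℕ → ℝ} (hmn : m < N + 1) (hk : k ≤ m)
    (h : HasOELShape N m k c) : ∑ j ∈ range N, c (j + 1) =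
      (if k = 0 then 0 else c k) + ∑ j ∈ Icc (k + 1) m, oelLow (N + 1) m j := by
  obtain ⟨hα, -, hlow, hhigh⟩ := h
  have h1 : ∑ j ∈ range N, c (j + 1) = ∑ j ∈ Icc 1 N, c j := by
    rw [range_eq_Ico, sum_Ico_add' c 0 N 1, zero_add]; rfl
  have h2 : ∑ j ∈ Icc (k + 1) m, oelLow (N + 1) m j = ∑ j ∈ Icc (k + 1) m, c j :=
    sum_congr rfl fun j hj => by
      have := mem_Icc.1 hj
      exact (hα j (by omega) (by omega) (by omega) (by omega)).symm
  rw [h1, h2]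
  split_ifs with hk0
  · subst hk0
    rw [zero_add]
    refine (sum_subset (fun j hj => ?_) fun j hj hj' => ?_).symm
    · simp only [mem_Icc] at *; omega
    · simp only [mem_Icc] at *
      exact hhigh j (by omega) (by omega) (by omega) (by omega)
  · rw [← sum_insert (by simp)]
    refine (sum_subset (fun j hj => ?_) fun j hj hj' => ?_).symm
    · simp only [mem_insert, mem_Icc] at *; omega
    · simp only [mem_insert, mem_Icc] at *
      rcases lt_or_ge j k with hjk | hjk
      · exact hlow j (by omega) (by omega) (by omega) (by omega)
      · exact hhigh j (by omega) (by omega) (by omega) (by omega)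

theorem sum_coeff_of_shape_high {c : ℕ → ℝ} (hk : m < k) (hkN : k ≤ N + 1)
    (h : HasOELShape N m k c) : ∑ j ∈ range N, c (j + 1) =
      (if k = N + 1 then 0 else c k) + ∑ j ∈ Icc (m + 1) (k - 1), oelHigh (N + 1) m j := by
  obtain ⟨-, hβ, hlow, hhigh⟩ := h
  have h1 : ∑ j ∈ range N, c (j + 1) = ∑ j ∈ Icc 1 N, c j := by
    rw [range_eq_Ico, sum_Ico_add' c 0 N 1, zero_add]; rfl
  have h2 : ∑ j ∈ Icc (m + 1) (k - 1), oelHigh (N + 1) m j = ∑ j ∈ Icc (m + 1) (k - 1), c j :=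
    sum_congr rfl fun j hj => by
      have := mem_Icc.1 hj
      exact (hβ j (by omega) (by omega) (by omega) (by omega)).symm
  rw [h1, h2]
  split_ifs with hk0
  · rw [zero_add]
    refine (sum_subset (fun j hj => ?_) fun j hj hj' => ?_).symm
    · simp only [mem_Icc] at *; omega
    · simp only [mem_Icc] at *
      exact hlow j (by omega) (by omega) (by omega) (by omega)
  · rw [← sum_insert (by simp; omega)]
    refine (sum_subset (fun j hj => ?_) fun j hj hj' => ?_).symm
    · simp only [mem_insert, mem_Icc] at *; omega
    · simp only [mem_insert, mem_Icc] at *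
      rcases lt_or_ge j k with hjk | hjk
      · exact hlow j (by omega) (by omega) (by omega) (by omega)
      · exact hhigh j (by omega) (by omega) (by omega) (by omega)

theorem hasOELShape_oelCoeff :
    HasOELShape N m k (oelCoeff (N + 1) m L U k) := by
  refine ⟨fun i h1 hN hki him => ?_, fun i h1 hN hmi hik => ?_, fun i h1 hN hik him => ?_,
    fun i h1 hN hki hmi => ?_⟩
  · unfold oelCoeff
    split_ifs <;> first | rfl | omega
  · unfold oelCoeff
    split_ifs <;> first | rfl | omega
  · unfold oelCoeff
    split_ifs <;> first | rfl | omega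
  · unfold oelCoeff
    split_ifs <;> first | rfl | omega

/-- The conditions on `c₀` and on the sum of the coefficients which say that the surplus vanishes
at the two extreme vertices other than the `k`-th. -/
theorem oelCoeff_ends (hmn : m < N + 1) (hk : k ≤ N + 1) :
    (1 ≤ k → -((N + 1) * oelCoeff (N + 1) m L U k 0) +
      L * ∑ j ∈ range (N + 1), surplusCoeff N m (oelCoeff (N + 1) m L U k) j = 0) ∧
    (k ≤ N → -((N + 1) * oelCoeff (N + 1) m L U k 0) +
      U * ∑ j ∈ range (N + 1), surplusCoeff N m (oelCoeff (N + 1) m L U k) j = 0) := by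
  rw [sum_surplusCoeff hmn]
  have hN : (N : ℝ) + 1 ≠ 0 := by positivity
  have hshape := hasOELShape_oelCoeff (N := N) (m := m) (k := k) (L := L) (U := U)
  rcases Nat.eq_zero_or_pos k with rfl | hk0
  · refine ⟨fun h => by omega, fun _ => ?_⟩
    rw [sum_coeff_of_shape_low hmn (by omega) hshape]
    simp only [oelCoeff, if_true, zero_add]
    push_cast
    field_simp
    ring
  rcases Nat.lt_or_ge N k with hkN | hkN
  · obtain rfl : k = N + 1 := by omega
    refine ⟨fun _ => ?_, fun h => by omega⟩
    rw [sum_coeff_of_shape_high hmn le_rfl hshape]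
    simp only [oelCoeff, if_true, zero_add, if_neg (show ¬ N + 1 = 0 by omega),
      if_neg (show ¬ N + 1 ≤ m by omega), if_neg (show ¬ N + 1 < N + 1 by omega)]
    push_cast
    field_simp
    ring
  · have h0 : oelCoeff (N + 1) m L U k 0 = 0 := by
      unfold oelCoeff
      split_ifs <;> first | rfl | omega
    have hsum : ((N : ℝ) + 1) * ∑ j ∈ range N, oelCoeff (N + 1) m L U k (j + 1) = m := by
      rcases Nat.lt_or_ge m k with hmk | hkm
      · rw [sum_coeff_of_shape_high hmk hk hshape, if_neg (by omega)]
        simp only [oelCoeff, if_true, if_neg (show ¬ k = 0 by omega),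
          if_neg (show ¬ k ≤ m by omega), if_pos (show k < N + 1 by omega)]
        push_cast
        field_simp
        ring
      · rw [sum_coeff_of_shape_low hmn hkm hshape, if_neg (by omega)]
        simp only [oelCoeff, if_true, if_neg (show ¬ k = 0 by omega), if_pos hkm]
        push_cast
        field_simp
        ring
    rw [h0, hsum]
    simp

/-- The surplus of the mechanism of index `k` vanishes at all vertices but the `k`-th. -/
theorem vertexSurplus_oelCoeff (hm : 1 ≤ m) (hmn : m < N + 1) (hk : k ≤ N + 1) {j : ℕ}
    (hj : j ≤ N + 1) (hjk : j ≠ k) : vertexSurplus N m L U (oelCoeff (N + 1) m L U k) j = 0 := by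
  have hcoeff := fun j hj hjk hjk' => (hasOELShape_oelCoeff (m := m) (k := k) (L := L)
    (U := U)).surplusCoeff_eq_zero hm hmn hk (j := j) hj hjk hjk'
  obtain ⟨h1, h2⟩ := oelCoeff_ends (L := L) (U := U) hmn hk
  rcases lt_or_gt_of_ne hjk with hlt | hgt
  · rw [vertexSurplus_of_lt hcoeff hk hlt, h1 (by omega)]
  · rw [vertexSurplus_of_gt hcoeff hgt hj, h2 (by omega)]

theorem surplusCoeff_eq_zero_of_vertexSurplus (hLU : L < U) {c : ℕ → ℝ}
    (h : ∀ j ≤ N + 1, j ≠ k → vertexSurplus N m L U c j = 0) {j : ℕ} (hj : j < N + 1)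
    (hjk : j ≠ k) (hjk' : j + 1 ≠ k) : surplusCoeff N m c j = 0 := by
  have h1 := vertexSurplus_succ_sub (N := N) (m := m) (L := L) (U := U) c j
  rw [h j hj.le hjk, h (j + 1) hj hjk', sub_self] at h1
  exact (mul_eq_zero.1 h1.symm).resolve_left (sub_pos.2 hLU).ne'

/-- A linear rule whose surplus vanishes at all vertices but the `k`-th has the coefficients of
index `k`. -/
theorem eq_oelCoeff (hm : 1 ≤ m) (hmn : m < N + 1) (hLU : L < U) (hk : k ≤ N + 1) {c : ℕ → ℝ}
    (h : ∀ j ≤ N + 1, j ≠ k → vertexSurplus N m L U c j = 0) {i : ℕ} (hi : i ≤ N) :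
    c i = oelCoeff (N + 1) m L U k i := by
  have hcoeff := fun j hj hjk hjk' =>
    surplusCoeff_eq_zero_of_vertexSurplus hLU h (j := j) hj hjk hjk'
  have hshape := hasOELShape_of_surplusCoeff_eq_zero hm hmn hcoeff
  have hshape' := hasOELShape_oelCoeff (N := N) (m := m) (k := k) (L := L) (U := U)
  obtain ⟨e1, e2⟩ := oelCoeff_ends (L := L) (U := U) hmn hk
  have d1 : 1 ≤ k → -((N + 1) * c 0) + L * ∑ j ∈ range (N + 1), surplusCoeff N m c j = 0 :=
    fun hk1 => by rw [← vertexSurplus_of_lt (U := U) hcoeff hk hk1, h 0 (by omega) (by omega)]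
  have d2 : k ≤ N → -((N + 1) * c 0) + U * ∑ j ∈ range (N + 1), surplusCoeff N m c j = 0 :=
    fun hk1 => by
      rw [← vertexSurplus_of_gt (L := L) hcoeff (Nat.lt_succ_of_le hk1) le_rfl,
        h (N + 1) le_rfl (by omega)]
  rw [sum_surplusCoeff hmn] at e1 e2 d1 d2
  have hN : (N : ℝ) + 1 ≠ 0 := by positivity
  have hoff : ∀ i, 1 ≤ i → i ≤ N → i ≠ k → c i = oelCoeff (N + 1) m L U k i := by
    intro i h1 hN hik
    rcases lt_or_gt_of_ne hik with hlt | hgt <;> rcases le_or_gt i m with him | him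
    · rw [hshape.2.2.1 i h1 hN hlt him, hshape'.2.2.1 i h1 hN hlt him]
    · rw [hshape.2.1 i h1 hN him hlt, hshape'.2.1 i h1 hN him hlt]
    · rw [hshape.1 i h1 hN hgt him, hshape'.1 i h1 hN hgt him]
    · rw [hshape.2.2.2 i h1 hN hgt him, hshape'.2.2.2 i h1 hN hgt him]
  by_cases hmid : 1 ≤ k ∧ k ≤ N
  · -- Both ends are controlled: `c₀ = 0` and the coefficients add up to `m / n`.
    have solve : ∀ x S : ℝ, -((N + 1) * x) + L * (m - (N + 1) * S) = 0 →
        -((N + 1) * x) + U * (m - (N + 1) * S) = 0 → x = 0 ∧ (N + 1) * S = m := by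
      intro x S h1 h2
      have h3 : (U - L) * (m - (N + 1) * S) = 0 := by linarith
      have h4 := (mul_eq_zero.1 h3).resolve_left (sub_pos.2 hLU).ne'
      rw [h4] at h1
      have h5 : ((N : ℝ) + 1) * x = 0 := by linarith
      exact ⟨(mul_eq_zero.1 h5).resolve_left hN, by linarith⟩
    obtain ⟨a1, a2⟩ := solve _ _ (d1 hmid.1) (d2 hmid.2)
    obtain ⟨b1, b2⟩ := solve _ _ (e1 hmid.1) (e2 hmid.2)
    rcases Nat.eq_zero_or_pos i with rfl | hi0
    · rw [a1, b1]
    by_cases hik : i = k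
    · subst hik
      have hs := mul_left_cancel₀ hN (a2.trans b2.symm)
      rw [← sum_erase_add _ _ (mem_range.2 (by omega : i - 1 < N)),
        ← sum_erase_add (f := fun j => oelCoeff (N + 1) m L U i (j + 1)) _
          (mem_range.2 (by omega : i - 1 < N)), Nat.sub_add_cancel hi0] at hs
      have hs' : ∑ j ∈ (range N).erase (i - 1), c (j + 1) =
          ∑ j ∈ (range N).erase (i - 1), oelCoeff (N + 1) m L U i (j + 1) :=
        sum_congr rfl fun j hj => by
          have h1 := (mem_erase.1 hj).1
          have h2 := mem_range.1 (mem_erase.1 hj).2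
          exact hoff (j + 1) (by omega) (by omega) (by omega)
      linarith
    · exact hoff i hi0 hi hik
  · have hs : ∑ j ∈ range N, c (j + 1) = ∑ j ∈ range N, oelCoeff (N + 1) m L U k (j + 1) :=
      sum_congr rfl fun j hj => by
        have := mem_range.1 hj
        exact hoff (j + 1) (by omega) (by omega) (by omega)
    rw [hs] at d1 d2
    rcases Nat.eq_zero_or_pos i with rfl | hi0
    · have h1 : ((N : ℝ) + 1) * (c 0 - oelCoeff (N + 1) m L U k 0) = 0 := by
        rcases Nat.eq_zero_or_pos k with hk0 | hk0
        · linarith [d2 (by omega), e2 (by omega)]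
        · linarith [d1 hk0, e1 hk0]
      linarith [(mul_eq_zero.1 h1).resolve_left hN]
    · exact hoff i hi0 hi (by omega)

/-- Nonnegativity of the surplus at the remaining vertex forces the parity of the index: the sign of
the coefficients next to `cₖ` alternates with `k`. -/
theorem odd_of_vertexSurplus_nonneg (hm : 1 ≤ m) (hmn : m < N + 1) (hLU : L < U) (hk : k ≤ N + 1)
    {c : ℕ → ℝ} (h : ∀ j ≤ N + 1, j ≠ k → vertexSurplus N m L U c j = 0)
    (h0 : 0 ≤ vertexSurplus N m L U c k) : Odd ((k : ℤ) - (m : ℤ)) := by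
  have hcoeff := fun j hj hjk hjk' =>
    surplusCoeff_eq_zero_of_vertexSurplus hLU h (j := j) hj hjk hjk'
  obtain ⟨hα, hβ, hlow, hhigh⟩ := hasOELShape_of_surplusCoeff_eq_zero hm hmn hcoeff
  have hLU' := sub_pos.2 hLU
  have habove : k ≤ N → surplusCoeff N m c k ≤ 0 := fun hkN => by
    have h1 := vertexSurplus_succ_sub (N := N) (m := m) (L := L) (U := U) c k
    rw [h (k + 1) (by omega) (by omega)] at h1
    by_contra! hpos
    have := mul_pos hLU' hpos
    linarith
  have hbelow : ∀ q, k = q + 1 → 0 ≤ surplusCoeff N m c q := fun q hq => by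
    have h1 := vertexSurplus_succ_sub (N := N) (m := m) (L := L) (U := U) c q
    rw [h q (by omega) (by omega), ← hq] at h1
    by_contra! hneg
    have := mul_neg_of_pos_of_neg hLU' hneg
    linarith
  -- For `k ≤ m` the entry below `cₖ` contributes nothing, whence the sign of `cₖ`.
  have hck_low : 1 ≤ k → k ≤ m → c k ≤ 0 := fun h1 hkm => by
    obtain ⟨q, rfl⟩ : ∃ q, k = q + 1 := ⟨k - 1, by omega⟩
    have h2 := hbelow q rfl
    have h3 : (q : ℝ) * c q = 0 := by
      rcases Nat.eq_zero_or_pos q with rfl | hq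
      · simp
      · rw [hlow q hq (by omega) (by omega) (by omega), mul_zero]
    rw [surplusCoeff, if_neg (by omega), h3] at h2
    have h4 : (0 : ℝ) < N - q := by
      have : (q : ℝ) + 1 ≤ N := by exact_mod_cast (by omega : q + 1 ≤ N)
      linarith
    by_contra! hpos
    have := mul_pos h4 hpos
    linarith
  have hnext : m ≤ k → k ≤ N → ((N : ℝ) - k) * c (k + 1) = 0 := fun hmk hkN => by
    rcases eq_or_lt_of_le hkN with rfl | hlt
    · simp
    · rw [hhigh (k + 1) (by omega) (by omega) (by omega) (by omega), mul_zero]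
  suffices H : Even (m + k + 1) by
    obtain ⟨r, hr⟩ := H
    exact ⟨(r : ℤ) - m - 1, by omega⟩
  rcases lt_trichotomy k m with hkm | rfl | hmk
  · refine even_of_oelLow_nonneg (i := k + 1) (by omega) hkm hmn ?_
    have h1 := habove (by omega)
    rw [surplusCoeff, if_neg (by omega), hα (k + 1) (by omega) (by omega) (by omega) hkm] at h1
    have h2 : (k : ℝ) * c k ≤ 0 := by
      rcases Nat.eq_zero_or_pos k with rfl | hk0
      · simp
      · exact mul_nonpos_of_nonneg_of_nonpos (by positivity) (hck_low hk0 hkm.le)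
    have h3 : (0 : ℝ) < N - k := by
      have : (k : ℝ) + 1 ≤ N := by exact_mod_cast (by omega : k + 1 ≤ N)
      linarith
    by_contra! hneg
    have := mul_neg_of_pos_of_neg h3 hneg
    linarith
  · have h1 := habove (by omega)
    rw [surplusCoeff, if_pos rfl, hnext le_rfl (by omega)] at h1
    have h2 : (k : ℝ) * c k ≤ 0 :=
      mul_nonpos_of_nonneg_of_nonpos (by positivity) (hck_low hm le_rfl)
    have h3 : (0 : ℝ) < k := by exact_mod_cast hm
    linarith
  · rcases eq_or_lt_of_le (Nat.succ_le_of_lt hmk) with rfl | hmk'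
    · exact ⟨m + 1, by omega⟩
    · obtain ⟨q, rfl⟩ : ∃ q, k = q + 1 := ⟨k - 1, by omega⟩
      have h1 := hbelow q rfl
      rw [surplusCoeff, if_neg (by omega), hβ q (by omega) (by omega) (by omega) (by omega)] at h1
      have h2 : 0 ≤ ((N : ℝ) - q) * c (q + 1) := by
        rcases eq_or_lt_of_le hk with hqN | hqN
        · obtain rfl : q = N := by omega
          simp
        · have h3 := habove (by omega)
          rw [surplusCoeff, if_neg (by omega), hnext hmk.le (by omega)] at h3
          have h4 : (0 : ℝ) < (q + 1 : ℕ) := by positivity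
          have h5 : 0 ≤ c (q + 1) := by
            by_contra! hneg
            have := mul_neg_of_pos_of_neg h4 hneg
            linarith
          have h6 : (q : ℝ) ≤ N := by exact_mod_cast (by omega : q ≤ N)
          exact mul_nonneg (by linarith) h5
      have h3 : oelHigh (N + 1) m q ≤ 0 := by
        by_contra! hpos
        have h4 : (0 : ℝ) < q := by exact_mod_cast (by omega : 0 < q)
        have := mul_pos h4 hpos
        linarith
      obtain ⟨r, hr⟩ := even_of_oelHigh_nonpos hm (by omega) (by omega) h3
      exact ⟨r + 1, by omega⟩

end Characterization

section Auction

variable {N m k : ℕ} {L U : ℝ}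

/-! ### Undominated linear mechanisms are OEL mechanisms -/

theorem card_filter_val_ge {n a : ℕ} : (univ.filter fun i : Fin n => a ≤ (i : ℕ)).card = n - a := by
  have h1 := card_filter_add_card_filter_not (s := (univ : Finset (Fin n))) fun i => (i : ℕ) < a
  rw [Fin.card_filter_val_lt, card_univ, Fintype.card_fin] at h1
  simp only [not_lt] at h1
  omega

theorem vertexSurplus_nonneg (hLU : L ≤ U) {c : ℕ → ℝ}
    (h : ∀ θ : Fin (N + 1) → Bid L U, 0 ≤ surplus N m c (topSeq θ)) (hk : k ≤ N + 1) :
    0 ≤ vertexSurplus N m L U c k := by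
  let θ : Fin (N + 1) → Bid L U := fun i =>
    if (i : ℕ) < k then ⟨U, hLU, le_rfl⟩ else ⟨L, le_rfl, hLU⟩
  have hU : ∀ j ≤ k, topSeq θ j = U := fun j hj => by
    refine le_antisymm (topSeq_mem hLU θ j).2 (le_topSeq le_rfl ?_)
    calc j ≤ (univ.filter fun i : Fin (N + 1) => (i : ℕ) < k).card := by
          rw [Fin.card_filter_val_lt]; omega
      _ ≤ _ := card_le_card fun i hi => by
          simp only [mem_filter, mem_univ, true_and] at hi
          simp [θ, hi]
  have hL : ∀ j, k < j → topSeq θ j = L := fun j hj => by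
    refine le_antisymm (topSeq_le le_rfl ?_) (topSeq_mem hLU θ j).1
    calc N + 1 + 1 ≤ j + (univ.filter fun i : Fin (N + 1) => k ≤ (i : ℕ)).card := by
          rw [card_filter_val_ge]; omega
      _ ≤ _ := by
          gcongr with i
          intro hi
          simp [θ, not_lt.2 hi]
  rw [← surplus_vertex c hk hU hL]
  exact h θ

theorem card_filter_cons {α : Type*} (p : α → Prop) [DecidablePred p] (a : α) (x : Fin N → α) :
    (univ.filter fun i => p ((Fin.cons a x : Fin (N + 1) → α) i)).card =
      (univ.filter fun i => p (x i)).card + if p a then 1 else 0 := by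
  rw [Fin.card_filter_univ_succ]
  simp only [Fin.cons_zero, Fin.cons_succ]
  split_ifs <;> rfl

/-- The surplus dominates the contribution of any single gap. -/
theorem vertexSurplus_mul_le (hLU : L ≤ U) {c : ℕ → ℝ}
    (h : ∀ j ≤ N + 1, 0 ≤ vertexSurplus N m L U c j) (θ : Fin (N + 1) → Bid L U) (hk : k ≤ N + 1) :
    vertexSurplus N m L U c k * (topSeq θ k - topSeq θ (k + 1)) ≤
      (U - L) * surplus N m c (topSeq θ) := by
  rw [mul_surplus_eq c (topSeq_zero θ) (topSeq_last θ)]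
  refine single_le_sum (f := fun k =>
    vertexSurplus N m L U c k * (topSeq θ k - topSeq θ (k + 1))) (fun j hj => ?_)
    (mem_range.2 (Nat.lt_succ_of_le hk))
  exact mul_nonneg (h j (Nat.lt_succ_iff.1 (mem_range.1 hj)))
    (sub_nonneg.2 (topSeq_succ_le hLU θ j))

/-- If the surplus is positive at two vertices `a < b`, it is bounded away from zero on the
profiles that extend `x = (U, …, U, μ, …, μ, L, …, L)`, with `a` entries `U` and `b - a - 1` entries
equal to the midpoint `μ`: an additional type cannot shrink both the gap `a` and the gap `b`. -/
theorem exists_surplus_bounded_below (hLU : L < U) {c : ℕ → ℝ}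
    (h : ∀ j ≤ N + 1, 0 ≤ vertexSurplus N m L U c j) {a b : ℕ} (hab : a < b) (hb : b ≤ N + 1)
    (ha0 : 0 < vertexSurplus N m L U c a) (hb0 : 0 < vertexSurplus N m L U c b) :
    ∃ (x : Fin N → Bid L U) (ε : ℝ), 0 < ε ∧
      ∀ y : Bid L U, ε ≤ surplus N m c (topSeq (Fin.cons y x : Fin (N + 1) → Bid L U)) := by
  set μ : ℝ := (L + U) / 2 with hμ
  have hLμ : L ≤ μ := by rw [hμ]; linarith
  have hμU : μ ≤ U := by rw [hμ]; linarith
  let x : Fin N → Bid L U := fun i =>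
    if (i : ℕ) < a then ⟨U, hLU.le, le_rfl⟩ else
      if (i : ℕ) + 1 < b then ⟨μ, hLμ, hμU⟩ else ⟨L, le_rfl, hLU.le⟩
  refine ⟨x, min (vertexSurplus N m L U c a) (vertexSurplus N m L U c b) / 2,
    half_pos (lt_min ha0 hb0), fun y => ?_⟩
  have key : ∀ k ≤ N + 1, 0 < vertexSurplus N m L U c k →
      min (vertexSurplus N m L U c a) (vertexSurplus N m L U c b) ≤ vertexSurplus N m L U c k →
      (U - L) / 2 ≤ topSeq (Fin.cons y x : Fin (N + 1) → Bid L U) k -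
        topSeq (Fin.cons y x : Fin (N + 1) → Bid L U) (k + 1) →
      min (vertexSurplus N m L U c a) (vertexSurplus N m L U c b) / 2 ≤
        surplus N m c (topSeq (Fin.cons y x : Fin (N + 1) → Bid L U)) := by
    intro k hk hpos hmin hgap
    have h1 := vertexSurplus_mul_le hLU.le h (Fin.cons y x : Fin (N + 1) → Bid L U) hk
    have h2 := mul_le_mul hmin hgap (by linarith) hpos.le
    have h3 : 0 < U - L := sub_pos.2 hLU
    refine le_of_mul_le_mul_left ?_ h3
    linarith
  by_cases hy : μ ≤ (y : ℝ)
  · refine key b hb hb0 (min_le_right _ _) ?_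
    have h1 : μ ≤ topSeq (Fin.cons y x : Fin (N + 1) → Bid L U) b := by
      refine le_topSeq hμU ?_
      rw [card_filter_cons (fun z : Bid L U => μ ≤ (z : ℝ)), if_pos hy]
      have h2 : (univ.filter fun i : Fin N => (i : ℕ) < b - 1).card ≤
          (univ.filter fun i => μ ≤ (x i : ℝ)).card := by
        gcongr with i
        intro hi
        simp only [x]
        split_ifs
        · exact hμU
        · exact le_rfl
        · omega
      rw [Fin.card_filter_val_lt] at h2
      omega
    have h2 : topSeq (Fin.cons y x : Fin (N + 1) → Bid L U) (b + 1) ≤ L := by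
      refine topSeq_le le_rfl ?_
      rw [card_filter_cons (fun z : Bid L U => (z : ℝ) ≤ L)]
      have h2 : (univ.filter fun i : Fin N => b - 1 ≤ (i : ℕ)).card ≤
          (univ.filter fun i => (x i : ℝ) ≤ L).card := by
        gcongr with i
        intro hi
        simp only [x]
        rw [if_neg (by omega), if_neg (by omega)]
      rw [card_filter_val_ge] at h2
      omega
    linarith
  · refine key a (by omega) ha0 (min_le_left _ _) ?_
    have h1 : U ≤ topSeq (Fin.cons y x : Fin (N + 1) → Bid L U) a := by
      refine le_topSeq le_rfl ?_
      rw [card_filter_cons (fun z : Bid L U => U ≤ (z : ℝ))]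
      have h2 : (univ.filter fun i : Fin N => (i : ℕ) < a).card ≤
          (univ.filter fun i => U ≤ (x i : ℝ)).card := by
        gcongr with i
        intro hi
        simp [x, hi]
      rw [Fin.card_filter_val_lt] at h2
      omega
    have h2 : topSeq (Fin.cons y x : Fin (N + 1) → Bid L U) (a + 1) ≤ μ := by
      refine topSeq_le hLμ ?_
      rw [card_filter_cons (fun z : Bid L U => (z : ℝ) ≤ μ), if_pos (not_le.1 hy).le]
      have h2 : (univ.filter fun i : Fin N => a ≤ (i : ℕ)).card ≤
          (univ.filter fun i => (x i : ℝ) ≤ μ).card := by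
        gcongr with i
        intro hi
        simp only [x]
        split_ifs
        · omega
        · exact le_rfl
        · exact hLμ
      rw [card_filter_val_ge] at h2
      omega
    linarith

theorem surplus_oelCoeff_eq_zero (hm : 1 ≤ m) (hmn : m < N + 1) (hLU : L ≤ U) (hk : k ≤ N + 1)
    {θ : Fin (N + 1) → Bid L U} (hθ : topSeq θ k = topSeq θ (k + 1)) :
    surplus N m (oelCoeff (N + 1) m L U k) (topSeq θ) = 0 := by
  rcases hLU.eq_or_lt with rfl | hlt
  · -- All vertices are the same profile, and at one of them the surplus is zero.
    have hconst : ∀ j, topSeq θ j = L := fun j =>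
      le_antisymm (topSeq_mem le_rfl θ j).2 (topSeq_mem le_rfl θ j).1
    obtain ⟨j, hj, hjk⟩ : ∃ j ≤ N + 1, j ≠ k := by
      rcases Nat.eq_zero_or_pos k with rfl | h
      · exact ⟨1, by omega, by omega⟩
      · exact ⟨0, by omega, by omega⟩
    rw [surplus_vertex (L := L) (U := L) _ hj (fun i _ => hconst i) (fun i _ => hconst i),
      vertexSurplus_oelCoeff hm hmn hk hj hjk]
  · have h := mul_surplus_eq (m := m) (oelCoeff (N + 1) m L U k) (topSeq_zero θ) (topSeq_last θ)
    rw [sum_eq_zero] at h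
    · exact (mul_eq_zero.1 h).resolve_left (sub_pos.2 hlt).ne'
    · intro j hj
      by_cases hjk : j = k
      · rw [hjk, hθ, sub_self, mul_zero]
      · rw [vertexSurplus_oelCoeff hm hmn hk (Nat.lt_succ_iff.1 (mem_range.1 hj)) hjk, zero_mul]

theorem isOEL_of_individuallyUndominated (hm : 1 ≤ m) (hmn : m < N + 1) (hL : 0 ≤ L) (hLU : L ≤ U)
    {M : Mechanism (N + 1) (Allocation (N + 1) m) (Bid L U)} {c : ℕ → ℝ}
    (hc : HasRedistribution (auctionValue (N + 1) m L U) M fun _ => linearRule c)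
    (hM : IndividuallyUndominated (auctionValue (N + 1) m L U) M) : IsOEL M := by
  have hG := hM.1.1
  have hsum := sum_payment_eq_surplus hL hmn hG hc
  have hnn : ∀ θ : Fin (N + 1) → Bid L U, 0 ≤ surplus N m c (topSeq θ) := fun θ => by
    rw [← hsum]; exact hM.1.2 θ
  have : Nonempty (Bid L U) := ⟨⟨L, le_rfl, hLU⟩⟩
  suffices H : ∃ k ≤ N + 1, Odd ((k : ℤ) - (m : ℤ)) ∧
      ∀ x : Fin N → Bid L U, linearRule c x = linearRule (oelCoeff (N + 1) m L U k) x by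
    obtain ⟨k, hk, hodd, heq⟩ := H
    exact ⟨hG, k, hk, hodd, fun θ i => by rw [hc θ i, funext heq]⟩
  rcases hLU.eq_or_lt with rfl | hlt
  · -- There is only one type, so that all indices give the mechanism with zero surplus.
    have : Subsingleton (Bid L L) := ⟨fun a b => Subtype.ext
      ((le_antisymm a.2.2 a.2.1).trans (le_antisymm b.2.2 b.2.1).symm)⟩
    refine ⟨m + 1, by omega, ⟨0, by push_cast; ring⟩, fun x => ?_⟩
    let θ : Fin (N + 1) → Bid L L := fun _ => ⟨L, le_rfl, le_rfl⟩
    have hconst : ∀ j, topSeq θ j = L := fun j =>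
      le_antisymm (topSeq_mem le_rfl θ j).2 (topSeq_mem le_rfl θ j).1
    have hs0 : surplus N m c (topSeq θ) = 0 := by
      refine le_antisymm (le_of_forall_pos_lt_add fun ε hε => ?_) (hnn θ)
      obtain ⟨y, hy⟩ := hM.exists_sum_lt x hε
      rw [hsum, Subsingleton.elim (Fin.cons y x : Fin (N + 1) → Bid L L) θ] at hy
      linarith
    have hs1 := surplus_oelCoeff_eq_zero (k := m + 1) hm hmn le_rfl (by omega)
      (θ := θ) (by rw [hconst, hconst])
    rw [surplus_eq hmn, ← sum_linearRule_removeNth] at hs0 hs1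
    have hx : ∀ i, Fin.removeNth i θ = x := fun i => Subsingleton.elim _ _
    simp only [hx, sum_const, card_univ, Fintype.card_fin, nsmul_eq_mul] at hs0 hs1
    have hN : ((N + 1 : ℕ) : ℝ) ≠ 0 := by positivity
    exact mul_left_cancel₀ hN (by linarith)
  · have hvn : ∀ j ≤ N + 1, 0 ≤ vertexSurplus N m L U c j := fun j hj =>
      vertexSurplus_nonneg hLU hnn hj
    have hno : ∀ a b, a < b → b ≤ N + 1 → 0 < vertexSurplus N m L U c a →
        0 < vertexSurplus N m L U c b → False := by
      intro a b hab hb ha0 hb0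
      obtain ⟨x, ε, hε, hbd⟩ := exists_surplus_bounded_below hlt hvn hab hb ha0 hb0
      obtain ⟨y, hy⟩ := hM.exists_sum_lt x hε
      rw [hsum] at hy
      linarith [hbd y]
    obtain ⟨k, hk, hzero⟩ : ∃ k ≤ N + 1, ∀ j ≤ N + 1, j ≠ k → vertexSurplus N m L U c j = 0 := by
      by_cases hex : ∃ k ≤ N + 1, 0 < vertexSurplus N m L U c k
      · obtain ⟨k, hk, hpos⟩ := hex
        refine ⟨k, hk, fun j hj hjk => le_antisymm ?_ (hvn j hj)⟩
        by_contra! hj0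
        rcases lt_or_gt_of_ne hjk with hlt | hgt
        · exact hno j k hlt hk hj0 hpos
        · exact hno k j hgt hj hpos hj0
      · push Not at hex
        exact ⟨0, by omega, fun j hj _ => le_antisymm (hex j hj) (hvn j hj)⟩
    refine ⟨k, hk, odd_of_vertexSurplus_nonneg hm hmn hlt hk hzero (hvn k hk), fun x => ?_⟩
    have heq := fun i hi => eq_oelCoeff hm hmn hlt hk hzero (i := i) hi
    rw [linearRule, linearRule, heq 0 (by omega)]
    congr 1
    exact sum_congr rfl fun j _ => by rw [heq (j + 1) (by omega)]

/-! ### OEL mechanisms are undominated -/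

theorem card_filter_update_ge (p : Bid L U → Prop) [DecidablePred p] {a : Bid L U} (ha : p a)
    (x : Fin N → Bid L U) (j : Fin N) :
    (univ.filter fun i => p (x i)).card ≤
      (univ.filter fun i => p (Function.update x j a i)).card := by
  refine card_le_card fun i hi => ?_
  by_cases hij : i = j
  · subst hij; simpa using ha
  · simpa [hij] using hi

/-- A symmetric `φ` vanishes if its sum over the deletions of `θ` vanishes whenever the `k`-th gap
of `θ` is zero: insert into `x` a second copy of its `k`-th highest entry (of `U` for `k = 0`, of
`L` for `k = n`). -/
theorem eq_zero_of_sum_removeNth_of_gap (hLU : L ≤ U) (hk : k ≤ N + 1)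
    {φ : (Fin N → Bid L U) → ℝ}
    (hφ : ∀ x (π : Equiv.Perm (Fin N)), φ (x ∘ π) = φ x)
    (h0 : ∀ θ : Fin (N + 1) → Bid L U, topSeq θ k = topSeq θ (k + 1) →
      ∑ i, φ (Fin.removeNth i θ) = 0) (x : Fin N → Bid L U) : φ x = 0 := by
  have hgap : ∀ θ : Fin (N + 1) → Bid L U, topSeq θ k ≤ topSeq θ (k + 1) →
      topSeq θ k = topSeq θ (k + 1) := fun θ h => le_antisymm h (topSeq_succ_le hLU θ k)
  rcases Nat.eq_zero_or_pos k with rfl | hk0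
  · refine eq_zero_of_sum_removeNth_cons hφ ⟨U, hLU, le_rfl⟩ Set.univ (fun _ _ _ => trivial)
      (fun x _ => h0 _ (hgap _ ?_)) x trivial
    rw [topSeq_zero]
    refine le_topSeq le_rfl ?_
    rw [card_filter_cons (fun z : Bid L U => U ≤ (z : ℝ)), if_pos le_rfl]
    omega
  rcases hk.eq_or_lt with rfl | hkN
  · refine eq_zero_of_sum_removeNth_cons hφ ⟨L, le_rfl, hLU⟩ Set.univ (fun _ _ _ => trivial)
      (fun x _ => h0 _ (hgap _ ?_)) x trivial
    rw [topSeq_last]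
    refine topSeq_le le_rfl ?_
    rw [card_filter_cons (fun z : Bid L U => (z : ℝ) ≤ L), if_pos le_rfl]
    omega
  have hkN' : k - 1 < N := by omega
  set a : Bid L U := x (sortDesc x ⟨k - 1, hkN'⟩) with ha
  refine eq_zero_of_sum_removeNth_cons hφ a
    {z | k ≤ (univ.filter fun i => (a : ℝ) ≤ z i).card ∧
      N + 1 ≤ k + (univ.filter fun i => (z i : ℝ) ≤ a).card}
    (fun z hz j => ⟨hz.1.trans (card_filter_update_ge (fun w => (a : ℝ) ≤ w) le_rfl z j),
      hz.2.trans (Nat.add_le_add_left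
        (card_filter_update_ge (fun w => (w : ℝ) ≤ a) le_rfl z j) k)⟩)
    (fun z hz => h0 _ (hgap _ ?_)) x ⟨?_, ?_⟩
  · refine (topSeq_le (v := (a : ℝ)) a.2.1 ?_).trans (le_topSeq a.2.2 ?_)
    · rw [card_filter_cons (fun w : Bid L U => (w : ℝ) ≤ a), if_pos le_rfl]
      have := hz.2
      omega
    · rw [card_filter_cons (fun w : Bid L U => (a : ℝ) ≤ w), if_pos le_rfl]
      have := hz.1
      omega
  · calc k = ((Iic (⟨k - 1, hkN'⟩ : Fin N)).map (sortDesc x).toEmbedding).card := by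
          rw [card_map, Fin.card_Iic]; simp only; omega
      _ ≤ _ := card_le_card fun i hi => by
          obtain ⟨j, hj, rfl⟩ := mem_map.1 hi
          simp only [mem_filter, mem_univ, true_and]
          exact antitone_sortDesc x (mem_Iic.1 hj)
  · calc N + 1 = k + ((Ici (⟨k - 1, hkN'⟩ : Fin N)).map (sortDesc x).toEmbedding).card := by
          rw [card_map, Fin.card_Ici]; simp only; omega
      _ ≤ _ := Nat.add_le_add_left (card_le_card fun i hi => by
          obtain ⟨j, hj, rfl⟩ := mem_map.1 hi
          simp only [mem_filter, mem_univ, true_and]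
          exact antitone_sortDesc x (mem_Ici.1 hj)) k

theorem collectivelyUndominated_of_isOEL (hm : 1 ≤ m) (hmn : m < N + 1) (hL : 0 ≤ L) (hLU : L ≤ U)
    {M : Mechanism (N + 1) (Allocation (N + 1) m) (Bid L U)} (hnd : NonDeficit M)
    (hM : IsOEL M) : CollectivelyUndominated (auctionValue (N + 1) m L U) M := by
  obtain ⟨hG, k, hk, -, hr⟩ := hM
  refine collectivelyUndominated_of_balanced hG hnd {θ | topSeq θ k = topSeq θ (k + 1)}
    (fun θ hθ σ => ?_) fun φ hφ h0 => eq_zero_of_sum_removeNth_of_gap hLU hk hφ h0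
  rw [sum_payment_eq_surplus hL hmn hG hr, topSeq_comp_perm]
  exact surplus_oelCoeff_eq_zero hm hmn hLU hk hθ

end Auction

end Redistribution

theorem mainTheorem4 (N m : ℕ) (hm : 1 ≤ m) (hmn : m < N + 1)
    (L U : ℝ) (hL : 0 ≤ L) (hLU : L ≤ U)
    (M : Redistribution.Mechanism (N + 1) (Redistribution.Allocation (N + 1) m)
      (Redistribution.Bid L U))
    (hlin : Redistribution.IsAnonymousLinearGroves M)
    (hnd : Redistribution.NonDeficit M) :
    (Redistribution.IndividuallyUndominated
        (Redistribution.auctionValue (N + 1) m L U) M ↔ Redistribution.IsOEL M) ∧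
    (Redistribution.CollectivelyUndominated
        (Redistribution.auctionValue (N + 1) m L U) M ↔ Redistribution.IsOEL M) ∧
    (Redistribution.IndividuallyUndominated
        (Redistribution.auctionValue (N + 1) m L U) M ↔
      Redistribution.CollectivelyUndominated
        (Redistribution.auctionValue (N + 1) m L U) M) := by
  obtain ⟨ρ, ⟨-, -, hρ⟩, c, hc⟩ := hlin
  obtain rfl : ρ = Redistribution.linearRule c := funext hc
  have h1 := Redistribution.isOEL_of_individuallyUndominated hm hmn hL hLU hρ
  have h2 := Redistribution.collectivelyUndominated_of_isOEL hm hmn hL hLU hnd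
  have h3 := Redistribution.CollectivelyUndominated.individuallyUndominated
    (v := Redistribution.auctionValue (N + 1) m L U) (M := M)
  exact ⟨⟨h1, fun h => h3 (h2 h)⟩, ⟨fun h => h1 (h3 h), h2⟩, ⟨fun h => h2 (h1 h), h3⟩⟩
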